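/- Identify each number $n$ with $\{0,\dots,n-1\}$. For $A\subseteq\omega$ let $[A]^2$ be the set of two-element subsets of $A$; a $k$-coloring of $[A]^2$ is a map $c:[A]^2\to k=\{0,\dots,k-1\}$, and for $x<y$ in $A$ we write $c(x,y)$ for $c(\{x,y\})$. A set $H\subseteq A$ is homogeneous for $c$ if $c$ is constant on $[H]^2$. For infinite $A$, the coloring $c$ is stable if for each $x\in A$ the limit $\lim_{y\in A} c(x,y)$ exists (i.e. $c(x,y)$ is eventually constant as $y\to\infty$ in $A$), and $L\subseteq A$ is limit-homogeneous for a stable $c$ if there is $j<k$ with $\lim_{y\in A} c(x,y)=j$ for all $x\in L$. For $X,Y\subseteq\omega$ write $Y\ll X$ if $X$ has PA degree relative to $Y$, i.e. every infinite tree $T\subseteq 2^{<\omega}$ computable from $Y$ has an infinite path computable from $X$; $X$ has PA degree if $\emptyset\ll X$. Let $\mathbb P$ be the following forcing notion. A condition is a triple $p=\langle n^p,c^p,\ell^p\rangle$ with $n^p\in\omega$, $c^p:[n^p]^2\to 2$ and $\ell^p:n^p\to 2\times\omega$, such that whenever $x<n^p$ and $\ell^p(x)=\langle v,u\rangle$,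 we have $c^p(x,y)=v$ for all $y$ with $x<y$ and $u\le y<n^p$. A condition $q$ extends $p$ ($q\le p$) if $n^q\ge n^p$, $c^q\supseteq c^p$ and $\ell^q\supseteq\ell^p$. A coloring $c:[\omega]^2\to 2$ extends $p$ if $c\supseteq c^p$ and, whenever $\ell^p(x)=\langle v,u\rangle$, $c(x,y)=v$ for all $y>x$ with $y\ge u$. The coloring $c$ is $1$-$X$-generic for $\mathbb P$ if for each $\Sigma^0_1(X)$-definable class $W$ of conditions (under the usual coding of conditions by natural numbers) there is a condition $p$ extended by $c$ such that either $p\in W$, or $q\notin W$ for all $q\le p$. (Such a $c$ is automatically stable.) Theorem. Let $X\subseteq\omega$ have PA degree, and let $c:[\omega]^2\to 2$ be $1$-$X$-generic for $\mathbb P$. Then for every $k\ge 2$, every infinite set $Y\ll X$ and every stable coloring $d:[Y]^2\to k$, there is an infinite set $L\subseteq Y$ that is limit-homogeneous for $d$ and computes no infinite homogeneous set for $c$. -/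

import Mathlib

namespace StableRamsey

/-! ### Oracle computability for sets of natural numbers -/

/-- The characteristic function of a set of natural numbers, as a (total) partial function. -/
noncomputable def chi (A : Set ℕ) : ℕ →. ℕ := fun n => Part.some (A.indicator 1 n)

/-- `B` is computable from `A` (Turing reducibility of sets). -/
def ComputableFrom (B A : Set ℕ) : Prop := TuringReducible (chi B) (chi A)

/-- A binary tree: a set of finite `0`-`1` strings closed under initial segments. -/
def IsBinaryTree (T : Set (List Bool)) : Prop :=
  ∀ σ ∈ T, ∀ τ : List Bool, τ <+: σ → τ ∈ T

/-- `P` is an infinite path through `T`: all its finite initial segments are in `T`. -/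
def IsPath (T : Set (List Bool)) (P : ℕ → Bool) : Prop :=
  ∀ n : ℕ, List.ofFn (fun i : Fin n => P i) ∈ T

open Classical in
/-- `X ≫ Y`: the set `X` has PA degree relative to `Y`, that is, every infinite binary tree
computable from `Y` has a path computable from `X`. -/
def PAOver (X Y : Set ℕ) : Prop :=
  ∀ T : Set (List Bool), IsBinaryTree T → T.Infinite →
    ComputableIn {chi Y} (fun σ : List Bool => decide (σ ∈ T)) →
    ∃ P : ℕ → Bool, ComputableIn {chi X} P ∧ IsPath T P

/-- `X` has PA degree. -/
def HasPADegree (X : Set ℕ) : Prop := PAOver X ∅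

/-! ### Colorings of pairs -/

/-- `[A]^2`: the two-element subsets of `A`, listed in increasing order. -/
def Pairs (A : Set ℕ) : Type := {p : ℕ × ℕ // p.1 ∈ A ∧ p.2 ∈ A ∧ p.1 < p.2}

/-- A `k`-coloring of `[A]^2`. -/
abbrev Coloring (A : Set ℕ) (k : ℕ) : Type := Pairs A → Fin k

/-- `H ⊆ A` is homogeneous for `c`: there is `j < k` with `c` constantly `j` on `[H]^2`. -/
def Homogeneous {A : Set ℕ} {k : ℕ} (c : Coloring A k) (H : Set ℕ) : Prop :=
  H ⊆ A ∧ ∃ j : Fin k, ∀ p : Pairs A, p.1.1 ∈ H → p.1.2 ∈ H → c p = j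

/-- `lim_y c(x, y) = j`, where `y` ranges over the elements of `A` above `x`. -/
def LimitColor {A : Set ℕ} {k : ℕ} (c : Coloring A k) (x : ℕ) (j : Fin k) : Prop :=
  ∃ z : ℕ, ∀ p : Pairs A, p.1.1 = x → z ≤ p.1.2 → c p = j

/-- `c` is stable: `lim_y c(x, y)` exists for every `x ∈ A`. -/
def Stable {A : Set ℕ} {k : ℕ} (c : Coloring A k) : Prop :=
  ∀ x ∈ A, ∃ j : Fin k, LimitColor c x j

/-- `L ⊆ A` is limit-homogeneous for `c`: there is `j < k` with `lim_y c(x, y) = j` for all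
`x ∈ L`. -/
def LimitHomogeneous {A : Set ℕ} {k : ℕ} (c : Coloring A k) (L : Set ℕ) : Prop :=
  L ⊆ A ∧ ∃ j : Fin k, ∀ x ∈ L, LimitColor c x j

/-! ### The stable-coloring forcing -/

/-- A condition `⟨n, c, ℓ⟩` of the forcing: `c : [n]^2 → 2` and `ℓ : n → 2 × ω`, such that
`ℓ x = ⟨v, u⟩` implies `c(x, y) = v` for all `y` with `x < y` and `u ≤ y < n`. -/
structure Condition where
  n : ℕ
  c : Coloring (Set.Iio n) 2
  l : Fin n → Fin 2 × ℕ
  compat : ∀ (x : Fin n) (e : Pairs (Set.Iio n)),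
    e.1.1 = x → (l x).2 ≤ e.1.2 → c e = (l x).1

/-- The inclusion `[A]^2 ⊆ [B]^2` for `A ⊆ B`. -/
def Pairs.incl {A B : Set ℕ} (h : A ⊆ B) (e : Pairs A) : Pairs B :=
  ⟨e.1, h e.2.1, h e.2.2.1, e.2.2.2⟩

/-- `q ≤ p`: the condition `q` extends the condition `p`. -/
def Condition.Extends (q p : Condition) : Prop :=
  ∃ h : p.n ≤ q.n,
    (∀ e : Pairs (Set.Iio p.n), q.c (e.incl (Set.Iio_subset_Iio h)) = p.c e) ∧
    ∀ x : Fin p.n, q.l (Fin.castLE h x) = p.l x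

/-- `c` extends `p`: it extends `c^p` as a function and respects `ℓ^p`. -/
def ColoringExtends (c : Coloring Set.univ 2) (p : Condition) : Prop :=
  (∀ e : Pairs (Set.Iio p.n), c (e.incl (Set.subset_univ _)) = p.c e) ∧
  ∀ (x : Fin p.n) (e : Pairs Set.univ), e.1.1 = x → (p.l x).2 ≤ e.1.2 → c e = (p.l x).1

/-- The standard coding of conditions by finite objects: the number `n`, for each `y < n` the
list `c(0, y), …, c(y - 1, y)`, and the list of values of `ℓ`. -/
def Condition.code (p : Condition) : ℕ × List (List (Fin 2)) × List (Fin 2 × ℕ) :=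
  (p.n,
    List.ofFn (fun y : Fin p.n => List.ofFn (fun x : Fin y =>
      p.c ⟨((x : ℕ), (y : ℕ)), x.2.trans y.2, y.2, x.2⟩)),
    List.ofFn p.l)

/-- `W` is a `Σ⁰₁(X)`-definable (that is, `X`-computably enumerable) class of conditions: the set
of conditions on whose codes some partial `X`-computable function is defined. -/
def SigmaOne (X : Set ℕ) (W : Set Condition) : Prop :=
  ∃ f : ℕ × List (List (Fin 2)) × List (Fin 2 × ℕ) →. ℕ,
    RecursiveIn {chi X} f ∧ ∀ p : Condition, p ∈ W ↔ (f p.code).Dom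

/-- The coloring `c` is `1`-`X`-generic: every `Σ⁰₁(X)` class of conditions is met or avoided by
some condition that `c` extends. -/
def OneGeneric (X : Set ℕ) (c : Coloring Set.univ 2) : Prop :=
  ∀ W : Set Condition, SigmaOne X W →
    ∃ p : Condition, ColoringExtends c p ∧
      (p ∈ W ∨ ∀ q : Condition, q.Extends p → q ∉ W)

end StableRamsey

/-! The limit colors of `d` split `Y` into `k` parts, and stability plays no further role: the claim
holds for every finite cover of `Y` (`exists_subset_of_cover`). The sets are built by a
Mathias-style forcing whose stages hold a finite set inside each part and one common infinite
reservoir `I` with `I ≪ X`. If some reservoir misses a part, induction on the number of parts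
applies to that reservoir; otherwise every part can be given an infinite set. It then suffices to
treat all tuples of functionals, one per part, and to defeat at least one entry of each tuple
(`Stage.exists_not_solves`).

To defeat an entry, consider the conditions `r` of the coloring forcing such that every cover of `I`
below `r.n` has a part in which some finite extension makes its functional accept a pair `x < y` in
conflict, meaning that `r` gives `(x, y)` a color different from the limit color promised for `x`.
No infinite homogeneous set contains such a pair. The class is `Σ⁰₁(X)`, so `c` meets or avoids it.

If `c` meets it, the actual cover is among those that split, and the finite extension is added to
the stage (`Stage.exists_of_splits`). If some `r` avoids it, stretching `r` so that all pairs of new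
points conflict shows that at every length some cover admits no accepted pair above `r.n`. These
covers form an infinite tree computable from `I`. A path gives a partition of `I` in which no part
lets its functional accept infinitely many numbers, and an infinite part becomes the new reservoir
(`Stage.exists_of_not_splits`).

For that reservoir to stay below `X`, the path must be computed by some `Z` with `I ≪ Z ≪ X`. Such a
`Z` exists because `≪` is dense (`PAOver.exists_between`), which follows from the fact that
diagonally noncomputable sets have PA degree (`DNC.paOver`). Throughout, oracle computations are
replaced by monotone primitive recursive functions of finite oracles (`exists_approx`), so that
trees and classes become primitive recursive. -/

namespace StableRamsey

variable {α β σ : Type*}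

/-! ### Finite initial segments of oracles -/

/-- The first `n` values of `P`. -/
def pre (P : ℕ → Bool) (n : ℕ) : List Bool := List.ofFn fun i : Fin n => P i

open Classical in
/-- The characteristic function of a set, with Boolean values. -/
noncomputable def bit (A : Set ℕ) : ℕ → Bool := fun n => decide (n ∈ A)

@[simp] theorem bit_eq_true {A : Set ℕ} {n : ℕ} : bit A n = true ↔ n ∈ A := by simp [bit]

@[simp] theorem bit_eq_false {A : Set ℕ} {n : ℕ} : bit A n = false ↔ n ∉ A := by simp [bit]

theorem chi_eq (A : Set ℕ) : chi A = fun n => Part.some (bit A n).toNat := by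
  funext n
  by_cases h : n ∈ A <;> simp [chi, bit, h]

@[simp] theorem length_pre (P : ℕ → Bool) (n : ℕ) : (pre P n).length = n := by simp [pre]

theorem pre_succ (P : ℕ → Bool) (n : ℕ) : pre P (n + 1) = pre P n ++ [P n] := by
  simp only [pre, List.ofFn_succ_last, Fin.val_castSucc, Fin.val_last]

theorem getElem?_pre (P : ℕ → Bool) (n i : ℕ) :
    (pre P n)[i]? = if i < n then some (P i) else none := by
  by_cases h : i < n <;> simp [pre, h]

theorem take_pre (P : ℕ → Bool) (m n : ℕ) : (pre P n).take m = pre P (min m n) := by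
  apply List.ext_getElem?
  intro i
  simp only [List.getElem?_take, getElem?_pre]
  grind

theorem pre_prefix (P : ℕ → Bool) {m n : ℕ} (h : m ≤ n) : pre P m <+: pre P n := by
  rw [← min_eq_left h, ← take_pre]
  exact List.take_prefix _ _

theorem eq_pre_of_prefix {P : ℕ → Bool} {n : ℕ} {σ : List Bool} (h : σ <+: pre P n) :
    σ = pre P σ.length := by
  have h1 := List.prefix_iff_eq_take.1 h
  have h2 := h.length_le
  rw [length_pre] at h2
  rw [take_pre, min_eq_left h2] at h1
  exact h1

theorem getElem?_of_prefix {σ τ : List β} (h : σ <+: τ) {i : ℕ} {b : β} (hi : σ[i]? = some b) :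
    τ[i]? = some b := by
  obtain ⟨ρ, rfl⟩ := h
  have : i < σ.length := by
    by_contra hc
    simp [List.getElem?_eq_none (not_lt.1 hc)] at hi
  rw [List.getElem?_append_left this, hi]

/-! ### Primitive recursive approximations to oracle computations -/

/-- `φ` is monotone in its finite oracle. -/
def MonoApprox (φ : List Bool → α → Option σ) : Prop :=
  ∀ ⦃τ τ' : List Bool⦄, τ <+: τ' → ∀ ⦃a b⦄, φ τ a = some b → φ τ' a = some b

/-- `φ`, run on the initial segments of `A`, computes `f`. -/
def Approximates (φ : List Bool → α → Option σ) (A : Set ℕ) (f : α →. σ) : Prop :=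
  ∀ a b, b ∈ f a ↔ ∃ s, φ (pre (bit A) s) a = some b

theorem MonoApprox.pre {φ : List Bool → α → Option σ} (h : MonoApprox φ) {P : ℕ → Bool} {s t : ℕ}
    (hst : s ≤ t) {a : α} {b : σ} (hs : φ (pre P s) a = some b) : φ (pre P t) a = some b :=
  h (pre_prefix P hst) hs

/-- The approximation to a composition. -/
def approxComp (φ ψ : List Bool → ℕ → Option ℕ) : List Bool → ℕ → Option ℕ :=
  fun τ n => (ψ τ n).bind (φ τ)

/-- The approximation to a primitive recursion. -/
def approxPrec (φ ψ : List Bool → ℕ → Option ℕ) : List Bool → ℕ → Option ℕ :=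
  fun τ p => p.unpair.2.rec (φ τ p.unpair.1)
    fun y IH => IH.bind fun i => ψ τ (Nat.pair p.unpair.1 (Nat.pair y i))

/-- The first `m < |τ|`, if any, at which `φ τ ⟨a, m⟩` fails to be a positive number. -/
def searchIdx (φ : List Bool → ℕ → Option ℕ) (τ : List Bool) (a : ℕ) : ℕ :=
  (List.range τ.length).findIdx fun m => ((φ τ (Nat.pair a m)).getD 0 == 0)

/-- The approximation to an unbounded search. -/
def approxRfind (φ : List Bool → ℕ → Option ℕ) : List Bool → ℕ → Option ℕ :=
  fun τ a => if φ τ (Nat.pair a (searchIdx φ τ a)) = some 0 then some (searchIdx φ τ a) else none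

/-- The search reads an undefined value as `0`, so it halts there and the final test rejects it.
Hence success certifies that all earlier values are defined and positive, which makes the search
monotone in `τ`. The bound is `≤` because `List.findIdx` returns the length of the list when nothing
is found. -/
theorem approxRfind_eq_some {φ : List Bool → ℕ → Option ℕ} {τ : List Bool} {a m : ℕ} :
    approxRfind φ τ a = some m ↔ m ≤ τ.length ∧ φ τ (Nat.pair a m) = some 0 ∧
      ∀ m' < m, ∃ k, φ τ (Nat.pair a m') = some (k + 1) := by
  have key : ∀ v : Option ℕ, v.getD 0 ≠ 0 ↔ ∃ k, v = some (k + 1) := by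
    intro v
    rcases v with _ | _ | v <;> simp
  have hle : searchIdx φ τ a ≤ τ.length := by
    have := List.findIdx_le_length (xs := List.range τ.length)
      (p := fun m => ((φ τ (Nat.pair a m)).getD 0 == 0))
    rwa [List.length_range] at this
  have hlt : ∀ m' < searchIdx φ τ a, ∃ k, φ τ (Nat.pair a m') = some (k + 1) := by
    intro m' hm'
    have h := List.not_of_lt_findIdx hm'
    rw [← key]
    simpa using h
  constructor
  · intro h
    unfold approxRfind at h
    split_ifs at h with h0
    cases h
    exact ⟨hle, h0, hlt⟩
  · rintro ⟨h1, h2, h3⟩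
    have : searchIdx φ τ a = m := by
      rcases lt_trichotomy (searchIdx φ τ a) m with h | h | h
      · obtain ⟨k, hk⟩ := h3 _ h
        have hl : searchIdx φ τ a < (List.range τ.length).length := by
          simpa using h.trans_le h1
        have h0 := List.findIdx_getElem (w := hl)
        have h1 : (List.range τ.length)[searchIdx φ τ a]'hl = searchIdx φ τ a :=
          List.getElem_range _
        change ((φ τ (Nat.pair a ((List.range τ.length)[searchIdx φ τ a]'hl))).getD 0 == 0) =
          true at h0
        simp [h1, hk] at h0
      · exact h
      · obtain ⟨k, hk⟩ := hlt _ h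
        simp [hk] at h2
    simp [approxRfind, this, h2]

theorem mem_rfind_eq_zero {p : ℕ → Part ℕ} {m : ℕ} :
    m ∈ Nat.rfind (fun n => (fun m => decide (m = 0)) <$> p n) ↔
      0 ∈ p m ∧ ∀ m' < m, ∃ k, k + 1 ∈ p m' := by
  refine Nat.mem_rfind.trans ?_
  have ht : ∀ q : Part ℕ, true ∈ (fun m => decide (m = 0)) <$> q ↔ 0 ∈ q := by
    intro q
    simp [Part.map_eq_map]
  have hf : ∀ q : Part ℕ, false ∈ (fun m => decide (m = 0)) <$> q ↔ ∃ k, k + 1 ∈ q := by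
    intro q
    rw [Part.map_eq_map, Part.mem_map_iff]
    constructor
    · rintro ⟨a, ha, h0⟩
      obtain ⟨k, rfl⟩ := Nat.exists_eq_succ_of_ne_zero (by simpa using h0)
      exact ⟨k, ha⟩
    · rintro ⟨k, hk⟩
      exact ⟨_, hk, by simp⟩
  exact and_congr (ht _) (forall_congr' fun m' => forall_congr' fun _ => hf _)

/-- By induction on the construction of `f`, with the length of the oracle string also bounding the
running time. Monotonicity lets the finitely many stages used by subcomputations be merged into
their maximum. -/
theorem exists_nat_approx {A : Set ℕ} {f : ℕ →. ℕ} (hf : Nat.RecursiveIn {chi A} f) :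
    ∃ φ : List Bool → ℕ → Option ℕ, Primrec₂ φ ∧ MonoApprox φ ∧ Approximates φ A f := by
  induction hf with
  | zero =>
    refine ⟨fun _ _ => some 0, Primrec₂.const _, fun _ _ _ _ _ h => h, fun a b => ?_⟩
    change b ∈ Part.some 0 ↔ _
    simp [eq_comm]
  | succ =>
    refine ⟨fun _ n => some n.succ, ?_, fun _ _ _ _ _ h => h, fun a b => ?_⟩
    · exact (Primrec.option_some.comp (Primrec.succ.comp Primrec.snd)).to₂
    · simp [eq_comm]
  | left =>
    refine ⟨fun _ n => some n.unpair.1, ?_, fun _ _ _ _ _ h => h, fun a b => ?_⟩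
    · exact (Primrec.option_some.comp (Primrec.fst.comp (Primrec.unpair.comp Primrec.snd))).to₂
    · simp [eq_comm]
  | right =>
    refine ⟨fun _ n => some n.unpair.2, ?_, fun _ _ _ _ _ h => h, fun a b => ?_⟩
    · exact (Primrec.option_some.comp (Primrec.snd.comp (Primrec.unpair.comp Primrec.snd))).to₂
    · simp [eq_comm]
  | oracle g hg =>
    rw [Set.mem_singleton_iff] at hg
    subst hg
    refine ⟨fun τ n => (τ[n]?).map Bool.toNat, ?_, ?_, fun a b => ?_⟩
    · exact (Primrec.option_map Primrec.list_getElem?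
        ((Primrec.dom_bool Bool.toNat).comp Primrec.snd).to₂)
    · intro τ τ' h a b hb
      obtain ⟨c, hc, rfl⟩ := Option.map_eq_some_iff.1 hb
      simp [getElem?_of_prefix h hc]
    · rw [chi_eq]
      simp only [Part.mem_some_iff, getElem?_pre]
      constructor
      · rintro rfl
        exact ⟨a + 1, by simp⟩
      · rintro ⟨s, hs⟩
        split_ifs at hs
        · simpa [eq_comm] using hs
        · simp at hs
  | pair _ _ ihf ihh =>
    obtain ⟨φ, p1, m1, a1⟩ := ihf
    obtain ⟨ψ, p2, m2, a2⟩ := ihh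
    refine ⟨fun τ n => (φ τ n).bind fun a => (ψ τ n).map (Nat.pair a), ?_, ?_, fun a b => ?_⟩
    · refine Primrec.option_bind p1 (Primrec₂.mk (Primrec.option_map
        (p2.comp (Primrec.fst.comp Primrec.fst) (Primrec.snd.comp Primrec.fst)) (Primrec₂.mk ?_)))
      exact Primrec₂.natPair.comp (Primrec.snd.comp Primrec.fst) Primrec.snd
    · intro τ τ' h a b hb
      simp only [Option.bind_eq_some_iff, Option.map_eq_some_iff] at hb ⊢
      obtain ⟨u, hu, v, hv, rfl⟩ := hb
      exact ⟨u, m1 h hu, v, m2 h hv, rfl⟩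
    · simp only [Seq.seq, Part.bind_map, Part.mem_bind_iff, Part.mem_map_iff, Part.map_eq_map,
        Option.bind_eq_some_iff, Option.map_eq_some_iff]
      constructor
      · rintro ⟨u, hu, v, hv, rfl⟩
        obtain ⟨s, hs⟩ := (a1 _ _).1 hu
        obtain ⟨t, ht⟩ := (a2 _ _).1 hv
        exact ⟨max s t, u, m1.pre (le_max_left _ _) hs, v, m2.pre (le_max_right _ _) ht, rfl⟩
      · rintro ⟨s, u, hu, v, hv, rfl⟩
        exact ⟨u, (a1 _ _).2 ⟨s, hu⟩, v, (a2 _ _).2 ⟨s, hv⟩, rfl⟩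
  | comp _ _ ihf ihh =>
    obtain ⟨φ, p1, m1, a1⟩ := ihf
    obtain ⟨ψ, p2, m2, a2⟩ := ihh
    refine ⟨approxComp φ ψ, ?_, ?_, fun a b => ?_⟩
    · exact (Primrec.option_bind p2 (p1.comp (Primrec.fst.comp Primrec.fst) Primrec.snd).to₂)
    · intro τ τ' h a b hb
      simp only [approxComp, Option.bind_eq_some_iff] at hb ⊢
      obtain ⟨u, hu, hv⟩ := hb
      exact ⟨u, m2 h hu, m1 h hv⟩
    · simp only [approxComp, Option.bind_eq_some_iff]
      refine Part.mem_bind_iff.trans ?_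
      constructor
      · rintro ⟨u, hu, hv⟩
        obtain ⟨s, hs⟩ := (a2 _ _).1 hu
        obtain ⟨t, ht⟩ := (a1 _ _).1 hv
        exact ⟨max s t, u, m2.pre (le_max_left _ _) hs, m1.pre (le_max_right _ _) ht⟩
      · rintro ⟨s, u, hu, hv⟩
        exact ⟨u, (a2 _ _).2 ⟨s, hu⟩, (a1 _ _).2 ⟨s, hv⟩⟩
  | @prec f h _ _ ihf ihh =>
    obtain ⟨φ, p1, m1, a1⟩ := ihf
    obtain ⟨ψ, p2, m2, a2⟩ := ihh
    have hmono : MonoApprox (approxPrec φ ψ) := by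
      intro τ τ' h p
      unfold approxPrec
      generalize p.unpair.2 = n
      induction n with
      | zero => exact fun b => m1 h (b := b)
      | succ n ih =>
        intro b hb
        simp only [Option.bind_eq_some_iff] at hb ⊢
        obtain ⟨u, hu, hv⟩ := hb
        exact ⟨u, ih hu, m2 h hv⟩
    refine ⟨approxPrec φ ψ, ?_, hmono, fun p => ?_⟩
    · refine Primrec.nat_rec' (Primrec.snd.comp (Primrec.unpair.comp Primrec.snd))
        (p1.comp Primrec.fst (Primrec.fst.comp (Primrec.unpair.comp Primrec.snd)))
        (h := fun q yi => yi.2.bind fun i =>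
          ψ q.1 (Nat.pair q.2.unpair.1 (Nat.pair yi.1 i))) (Primrec₂.mk ?_)
      refine Primrec.option_bind (Primrec.snd.comp Primrec.snd) (Primrec₂.mk ?_)
      refine p2.comp (Primrec.fst.comp (Primrec.fst.comp Primrec.fst)) ?_
      refine Primrec₂.natPair.comp (Primrec.fst.comp (Primrec.unpair.comp
        (Primrec.snd.comp (Primrec.fst.comp Primrec.fst)))) ?_
      exact Primrec₂.natPair.comp (Primrec.fst.comp (Primrec.snd.comp Primrec.fst)) Primrec.snd
    · have hmono' : ∀ (a n : ℕ) ⦃s t : ℕ⦄, s ≤ t → ∀ b,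
          approxPrec φ ψ (pre (bit A) s) (Nat.pair a n) = some b →
          approxPrec φ ψ (pre (bit A) t) (Nat.pair a n) = some b :=
        fun a n s t hst b hb => hmono.pre hst hb
      simp only [approxPrec, Nat.unpair_pair] at hmono' ⊢
      generalize p.unpair.1 = a at *
      generalize p.unpair.2 = n at *
      induction n with
      | zero => exact fun b => a1 a b
      | succ n ih =>
        intro b
        simp only [Option.bind_eq_some_iff]
        refine Part.mem_bind_iff.trans ?_
        constructor
        · rintro ⟨u, hu, hv⟩
          obtain ⟨s, hs⟩ := (ih _).1 hu
          obtain ⟨t, ht⟩ := (a2 _ _).1 hv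
          exact ⟨max s t, u, hmono' a n (le_max_left _ _) _ hs, m2.pre (le_max_right _ _) ht⟩
        · rintro ⟨s, u, hu, hv⟩
          exact ⟨u, (ih _).2 ⟨s, hu⟩, (a2 _ _).2 ⟨s, hv⟩⟩
  | rfind _ ihf =>
    obtain ⟨φ, p1, m1, a1⟩ := ihf
    refine ⟨approxRfind φ, ?_, ?_, fun a m => ?_⟩
    · have hs : Primrec₂ (searchIdx φ) := by
        refine Primrec.list_findIdx (Primrec.list_range.comp (Primrec.list_length.comp Primrec.fst))
          ?_
        refine Primrec₂.mk (Primrec.beq.comp (Primrec.option_getD.comp ?_ (Primrec.const 0))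
          (Primrec.const 0))
        exact p1.comp (Primrec.fst.comp Primrec.fst)
          (Primrec₂.natPair.comp (Primrec.snd.comp Primrec.fst) Primrec.snd)
      refine Primrec.ite (Primrec.eq.comp (p1.comp Primrec.fst
        (Primrec₂.natPair.comp Primrec.snd hs)) (Primrec.const _))
        (Primrec.option_some.comp hs) (Primrec.const _)
    · intro τ τ' h a b hb
      rw [approxRfind_eq_some] at hb ⊢
      exact ⟨hb.1.trans h.length_le, m1 h hb.2.1,
        fun m' hm' => (hb.2.2 m' hm').imp fun k hk => m1 h hk⟩
    · simp only [approxRfind_eq_some, length_pre]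
      refine mem_rfind_eq_zero.trans ?_
      constructor
      · rintro ⟨hz, h2⟩
        obtain ⟨s, hs⟩ := (a1 _ _).1 hz
        have : ∀ m', ∃ t, m' < m → ∃ k, φ (pre (bit A) t) (Nat.pair a m') = some (k + 1) := by
          intro m'
          by_cases hm : m' < m
          · obtain ⟨k, hk⟩ := h2 _ hm
            obtain ⟨t, ht⟩ := (a1 _ _).1 hk
            exact ⟨t, fun _ => ⟨k, ht⟩⟩
          · exact ⟨0, fun h => absurd h hm⟩
        choose t ht using this
        -- The stage must exceed `m` too, since the approximation searches only up to the length of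
        -- the oracle.
        refine ⟨max (max s m) ((Finset.range m).sup t), le_max_of_le_left (le_max_right _ _),
          m1.pre (le_max_of_le_left (le_max_left _ _)) hs, fun m' hm' => ?_⟩
        obtain ⟨k, hk⟩ := ht m' hm'
        exact ⟨k, m1.pre (le_max_of_le_right (Finset.le_sup (f := t) (Finset.mem_range.2 hm'))) hk⟩
      · rintro ⟨s, -, h1, h2⟩
        exact ⟨(a1 _ _).2 ⟨s, h1⟩, fun m' hm' => (h2 m' hm').imp fun k hk => (a1 _ _).2 ⟨s, hk⟩⟩

variable [Primcodable α] [Primcodable β] [Primcodable σ]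

/-- Every function recursive in `A` has a monotone primitive recursive approximation. -/
theorem exists_approx {A : Set ℕ} {f : α →. σ} (hf : RecursiveIn {chi A} f) :
    ∃ φ : List Bool → α → Option σ, Primrec₂ φ ∧ MonoApprox φ ∧ Approximates φ A f := by
  obtain ⟨φ, p, m, a⟩ := exists_nat_approx hf
  refine ⟨fun τ a => (φ τ (Encodable.encode a)).bind Encodable.decode, ?_, ?_, fun x y => ?_⟩
  · exact Primrec.option_bind (p.comp Primrec.fst (Primrec.encode.comp Primrec.snd))
      (Primrec.decode.comp Primrec.snd).to₂
  · intro τ τ' h a b hb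
    simp only [Option.bind_eq_some_iff] at hb ⊢
    obtain ⟨u, hu, hv⟩ := hb
    exact ⟨u, m h hu, hv⟩
  · have h := a (Encodable.encode x)
    simp only [Encodable.encodek, Part.coe_some, Part.bind_some, Part.mem_map_iff] at h
    simp only [Option.bind_eq_some_iff]
    constructor
    · intro hy
      obtain ⟨s, hs⟩ := (h _).1 ⟨y, hy, rfl⟩
      exact ⟨s, _, hs, Encodable.encodek _⟩
    · rintro ⟨s, u, hu, hv⟩
      obtain ⟨z, hz, rfl⟩ := (h _).2 ⟨s, hu⟩
      rw [Encodable.encodek, Option.some_inj] at hv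
      exact hv ▸ hz

/-! ### From primitive recursive approximations back to oracle computations -/

theorem recursiveIn_pre (A : Set ℕ) :
    Nat.RecursiveIn {chi A} fun s => Part.some (Encodable.encode (pre (bit A) s)) := by
  -- one step of the recursion: append the oracle's answer to the list
  have hstep : Nat.RecursiveIn {chi A} (fun n => Part.some
      (Encodable.encode (((Encodable.decode (α := List Bool) n.unpair.2.unpair.2).getD []) ++
        [bit A n.unpair.2.unpair.1]))) := by
    have hP : Primrec fun p : ℕ => Encodable.encode
        (((Encodable.decode (α := List Bool) p.unpair.1.unpair.2.unpair.2).getD []) ++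
          [p.unpair.2 == 1]) := by
      refine Primrec.encode.comp (Primrec.list_append.comp (Primrec.option_getD.comp
        (Primrec.decode.comp ?_) (Primrec.const _)) (Primrec.list_cons.comp (Primrec.beq.comp
        (Primrec.snd.comp Primrec.unpair) (Primrec.const _)) (Primrec.const _)))
      exact Primrec.snd.comp (Primrec.unpair.comp (Primrec.snd.comp (Primrec.unpair.comp
        (Primrec.fst.comp Primrec.unpair))))
    have hid : Nat.RecursiveIn {chi A} (fun n : ℕ => Part.some n) :=
      (Nat.Primrec.id).recursiveIn
    have hy : Nat.RecursiveIn {chi A} (fun n : ℕ => Part.some n.unpair.2.unpair.1) :=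
      (Primrec.nat_iff.1 (Primrec.fst.comp (Primrec.unpair.comp (Primrec.snd.comp
        Primrec.unpair)))).recursiveIn
    have ho := Nat.RecursiveIn.comp (Nat.RecursiveIn.oracle (O := {chi A}) (chi A) rfl) hy
    refine (Nat.RecursiveIn.comp (Primrec.nat_iff.1 hP).recursiveIn
      (Nat.RecursiveIn.pair hid ho)).of_eq fun n => ?_
    simp only [chi_eq, Part.bind_eq_bind, Part.bind_some, Seq.seq, Part.map_eq_map,
      Part.map_some, Nat.unpair_pair]
    cases bit A (Nat.unpair (Nat.unpair n).2).1 <;> simp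
  have h0 : Nat.RecursiveIn {chi A} (fun _ => Part.some (Encodable.encode ([] : List Bool))) :=
    (Nat.Primrec.const _).recursiveIn
  have hp : Nat.RecursiveIn {chi A} (fun s => Part.some (Nat.pair 0 s)) :=
    (Primrec.nat_iff.1 (Primrec₂.natPair.comp (Primrec.const 0) Primrec.id)).recursiveIn
  refine ((Nat.RecursiveIn.prec h0 hstep).comp hp).of_eq fun s => ?_
  simp only [Part.bind_eq_bind, Part.bind_some, Nat.unpair_pair]
  induction s with
  | zero => simp [pre]
  | succ s ih =>
    simp only [ih, Part.bind_some, Encodable.encodek, pre_succ, Option.getD_some]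

/-- A function with a primitive recursive approximation relative to `A` is recursive in `A`. -/
theorem Approximates.recursiveIn {A : Set ℕ} {f : α →. σ} {φ : List Bool → α → Option σ}
    (hφ : Primrec₂ φ) (h : Approximates φ A f) : RecursiveIn {chi A} f := by
  -- the value of the approximation, as a number: `0` for `none`
  let g : ℕ → ℕ := fun p => Encodable.encode
    ((Encodable.decode (α := List Bool) p.unpair.2).bind fun τ =>
      (Encodable.decode (α := α) p.unpair.1).bind (φ τ))
  have hg : Primrec g := by
    refine Primrec.encode.comp (Primrec.option_bind (Primrec.decode.comp (Primrec.snd.comp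
      Primrec.unpair)) (Primrec₂.mk (Primrec.option_bind (Primrec.decode.comp (Primrec.fst.comp
      (Primrec.unpair.comp Primrec.fst))) (Primrec₂.mk ?_))))
    exact hφ.comp (Primrec.snd.comp Primrec.fst) Primrec.snd
  let v : ℕ → ℕ := fun p =>
    g (Nat.pair p.unpair.1 (Encodable.encode (pre (bit A) p.unpair.2)))
  have hv : Nat.RecursiveIn {chi A} fun p => Part.some (v p) := by
    have hl : Nat.RecursiveIn {chi A} (fun n : ℕ => Part.some n.unpair.1) := .left
    have hr : Nat.RecursiveIn {chi A} (fun n : ℕ => Part.some n.unpair.2) := .right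
    refine (Nat.RecursiveIn.comp (Primrec.nat_iff.1 hg).recursiveIn
      (Nat.RecursiveIn.pair hl ((recursiveIn_pre A).comp hr))).of_eq fun p => ?_
    simp [Seq.seq, v]
  -- `v` is `0` for `none` and a successor for `some`, so `1 - v` vanishes exactly at the stages
  -- with a value. Unbounded search finds the first such stage, and the predecessor of `v` there is
  -- the code of the value.
  have hv' : Nat.RecursiveIn {chi A} fun p => Part.some (1 - v p) := by
    refine (Nat.RecursiveIn.comp (Primrec.nat_iff.1
      (Primrec.nat_sub.comp (Primrec.const 1) Primrec.id)).recursiveIn hv).of_eq fun p => ?_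
    simp
  have hs := Nat.RecursiveIn.rfind hv'
  have hid : Nat.RecursiveIn {chi A} (fun n : ℕ => Part.some n) := (Nat.Primrec.id).recursiveIn
  have hfin := Nat.RecursiveIn.comp (Primrec.nat_iff.1 Primrec.pred).recursiveIn
    (Nat.RecursiveIn.comp hv (Nat.RecursiveIn.pair hid hs))
  refine hfin.of_eq fun n => ?_
  ext m
  have hval : ∀ a s, Encodable.decode (α := α) n = some a →
      v (Nat.pair n s) = Encodable.encode (φ (pre (bit A) s) a) := by
    intro a s ha
    simp [v, g, ha]
  have hnone : ∀ s, Encodable.decode (α := α) n = none → v (Nat.pair n s) = 0 := by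
    intro s ha
    simp [v, g, ha]
  have hmem : ∀ s, s ∈ Nat.rfind (fun s => (fun m => decide (m = 0)) <$>
      Part.some (1 - v (Nat.pair n s))) ↔ v (Nat.pair n s) ≠ 0 ∧ ∀ t < s, v (Nat.pair n t) = 0 := by
    intro s
    refine mem_rfind_eq_zero.trans ?_
    simp only [Part.mem_some_iff]
    refine and_congr (by omega) (forall_congr' fun t => forall_congr' fun _ => ?_)
    constructor
    · rintro ⟨k, hk⟩
      omega
    · intro h
      exact ⟨0, by omega⟩
  have hL : ∀ R : Part ℕ, m ∈ ((Nat.pair <$> Part.some n <*> R) >>= fun p => Part.some (v p)) >>=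
      (fun q => Part.some q.pred) ↔ ∃ s ∈ R, m = (v (Nat.pair n s)).pred := by
    intro R
    simp [Seq.seq, Part.map_eq_map]
  refine (hL _).trans ?_
  simp only [hmem]
  cases hd : Encodable.decode (α := α) n with
  | none => simp [hnone _ hd]
  | some a =>
    simp only [Part.coe_some, Part.bind_some, Part.mem_map_iff, hval a _ hd]
    constructor
    · rintro ⟨s, ⟨h1, -⟩, rfl⟩
      cases hq : φ (pre (bit A) s) a with
      | none => simp [hq] at h1
      | some b => exact ⟨b, (h a b).2 ⟨s, hq⟩, by simp⟩
    · rintro ⟨b, hb, rfl⟩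
      have hex : ∃ s, (φ (pre (bit A) s) a).isSome := by
        obtain ⟨s, hs⟩ := (h a b).1 hb
        exact ⟨s, by simp [hs]⟩
      classical
      obtain ⟨b', hb'⟩ := Option.isSome_iff_exists.1 (Nat.find_spec hex)
      have : b' = b := Part.mem_unique ((h a b').2 ⟨_, hb'⟩) hb
      subst this
      refine ⟨Nat.find hex, ⟨by simp [hb'], fun m hm => ?_⟩, by simp [hb']⟩
      have := Nat.find_min hex hm
      rw [Option.not_isSome_iff_eq_none] at this
      simp [this]

end StableRamsey

namespace StableRamsey

variable {α β σ : Type*} [Primcodable α] [Primcodable β] [Primcodable σ]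

/-! ### Primitive recursive predicates with bounded quantifiers -/

theorem primrecPred_ball_lt {p : α → ℕ → Prop} {f : α → ℕ} (hf : Primrec f)
    (hp : PrimrecPred fun x : α × ℕ => p x.1 x.2) : PrimrecPred fun a => ∀ x < f a, p a x :=
  ((PrimrecRel.forall_mem_list (R := fun x a => p a x)
    (hp.comp (Primrec.pair Primrec.snd Primrec.fst))).comp (Primrec.list_range.comp hf)
    Primrec.id).of_eq fun _ => by simp

theorem primrecPred_bex_lt {p : α → ℕ → Prop} {f : α → ℕ} (hf : Primrec f)
    (hp : PrimrecPred fun x : α × ℕ => p x.1 x.2) : PrimrecPred fun a => ∃ x < f a, p a x :=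
  ((PrimrecRel.exists_mem_list (R := fun x a => p a x)
    (hp.comp (Primrec.pair Primrec.snd Primrec.fst))).comp (Primrec.list_range.comp hf)
    Primrec.id).of_eq fun _ => by simp

theorem primrecPred_ball_mem {p : α → β → Prop} {f : α → List β} (hf : Primrec f)
    (hp : PrimrecPred fun x : α × β => p x.1 x.2) : PrimrecPred fun a => ∀ x ∈ f a, p a x :=
  (PrimrecRel.forall_mem_list (R := fun x a => p a x)
    (hp.comp (Primrec.pair Primrec.snd Primrec.fst))).comp hf Primrec.id

theorem primrecPred_bex_mem {p : α → β → Prop} {f : α → List β} (hf : Primrec f)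
    (hp : PrimrecPred fun x : α × β => p x.1 x.2) : PrimrecPred fun a => ∃ x ∈ f a, p a x :=
  (PrimrecRel.exists_mem_list (R := fun x a => p a x)
    (hp.comp (Primrec.pair Primrec.snd Primrec.fst))).comp hf Primrec.id

theorem primrecPred_imp {p q : α → Prop} (hp : PrimrecPred p) (hq : PrimrecPred q) :
    PrimrecPred fun a => p a → q a :=
  (hp.not.or hq).of_eq fun _ => imp_iff_not_or.symm

theorem primrecPred_const (p : Prop) : PrimrecPred fun _ : α => p := by
  by_cases h : p
  · exact ((Primrec.eq (α := ℕ)).comp (Primrec.const 0) (Primrec.const 0)).of_eq fun _ => by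
      simp [h]
  · exact ((Primrec.eq (α := ℕ)).comp (Primrec.const 0) (Primrec.const 1)).of_eq fun _ => by
      simp [h]

theorem primrecPred_exists_fin {k : ℕ} {p : Fin k → α → Prop} (hp : ∀ i, PrimrecPred (p i)) :
    PrimrecPred fun a => ∃ i, p i a := by
  induction k with
  | zero => exact (primrecPred_const False).of_eq fun _ => by simp
  | succ k ih =>
    exact ((hp 0).or (ih fun i => hp i.succ)).of_eq fun _ => by rw [Fin.exists_fin_succ]

/-- All binary strings of length at most `n`. -/
def boolLists (n : ℕ) : List (List Bool) :=
  n.rec [[]] fun _ L => [] :: (L.map (List.cons true) ++ L.map (List.cons false))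

theorem mem_boolLists {n : ℕ} {τ : List Bool} : τ ∈ boolLists n ↔ τ.length ≤ n := by
  induction n generalizing τ with
  | zero => simp [boolLists]
  | succ n ih =>
    have : boolLists (n + 1) = [] :: ((boolLists n).map (List.cons true) ++
      (boolLists n).map (List.cons false)) := rfl
    rw [this]
    rcases τ with _ | ⟨b, τ⟩
    · simp
    · cases b <;> simp [ih]

theorem primrec_boolLists : Primrec boolLists := by
  have hc : ∀ b : Bool, Primrec fun p : ℕ × List (List Bool) => p.2.map (List.cons b) := fun b =>
    Primrec.list_map Primrec.snd (Primrec₂.mk (Primrec.list_cons.comp (Primrec.const b)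
      Primrec.snd))
  exact Primrec.nat_rec₁ _ (Primrec₂.mk (Primrec.list_cons.comp (Primrec.const [])
    (Primrec.list_append.comp (hc true) (hc false))))

/-! ### Computability from sets -/

theorem ComputableFrom.refl (A : Set ℕ) : ComputableFrom A A := TuringReducible.refl _

theorem ComputableFrom.trans {A B C : Set ℕ} (h : ComputableFrom A B) (h' : ComputableFrom B C) :
    ComputableFrom A C := TuringReducible.trans h h'

theorem ComputableFrom.recursiveIn {A B : Set ℕ} (h : ComputableFrom A B) {f : α →. σ}
    (hf : RecursiveIn {chi A} f) : RecursiveIn {chi B} f :=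
  hf.subst fun g hg => by rw [Set.mem_singleton_iff.1 hg]; exact h

theorem computableIn_pre (A : Set ℕ) {g : List Bool → α → σ} {len : α → ℕ} (hg : Primrec₂ g)
    (hlen : Primrec len) : ComputableIn {chi A} fun a => g (pre (bit A) (len a)) a := by
  refine Approximates.recursiveIn (A := A)
    (φ := fun τ a => if len a ≤ τ.length then some (g (τ.take (len a)) a) else none) ?_ ?_
  · refine Primrec.ite (Primrec.nat_le.comp (hlen.comp Primrec.snd)
      (Primrec.list_length.comp Primrec.fst)) (Primrec.option_some.comp (hg.comp
      (Primrec.list_take.comp (hlen.comp Primrec.snd) Primrec.fst) Primrec.snd)) (Primrec.const _)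
  · intro a b
    simp only [Part.mem_some_iff, length_pre, take_pre]
    constructor
    · rintro rfl
      exact ⟨len a, by simp⟩
    · rintro ⟨s, hs⟩
      split_ifs at hs with h
      rw [min_eq_left h] at hs
      simpa [eq_comm] using hs

theorem computableFrom_setOf {X : Set ℕ} {P : ℕ → Bool} (hP : ComputableIn {chi X} P) {g : ℕ → ℕ}
    (hg : Primrec g) : ComputableFrom {j | P (g j) = true} X := by
  obtain ⟨φ, p, -, a⟩ := exists_approx hP
  refine Approximates.recursiveIn (φ := fun τ n => (φ τ (g n)).map Bool.toNat) ?_ ?_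
  · exact Primrec.option_map (p.comp Primrec.fst (hg.comp Primrec.snd))
      (Primrec₂.mk ((Primrec.dom_bool _).comp Primrec.snd))
  · intro n b
    have h := a (g n)
    have hb : bit {j | P (g j) = true} n = P (g n) := by
      rw [Bool.eq_iff_iff]
      simp
    simp only [Part.mem_some_iff] at h
    simp only [chi_eq, hb, Part.mem_some_iff, Option.map_eq_some_iff]
    constructor
    · rintro rfl
      obtain ⟨s, hs⟩ := (h _).1 rfl
      exact ⟨s, _, hs, rfl⟩
    · rintro ⟨s, b', hs, rfl⟩
      rw [(h b').2 ⟨s, hs⟩]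

/-! ### PA degrees: monotonicity and paths through uniformly given trees -/

theorem PAOver.mono_left {X X' Y : Set ℕ} (h : PAOver X Y) (hX : ComputableFrom X X') :
    PAOver X' Y := fun T hT hinf hc =>
  (h T hT hinf hc).imp fun _ hP => ⟨hX.recursiveIn hP.1, hP.2⟩

theorem PAOver.mono_right {X Y Y' : Set ℕ} (h : PAOver X Y) (hY : ComputableFrom Y' Y) :
    PAOver X Y' := fun T hT hinf hc => h T hT hinf (hY.recursiveIn hc)

/-- A set of PA degree over `Y` computes a path through every tree uniformly primitive recursive
in `Y`, provided the tree has strings of every length. -/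
theorem PAOver.exists_path {X Y : Set ℕ} (h : PAOver X Y) {R : List Bool → List Bool → Prop}
    (hR : PrimrecRel R)
    (htree : ∀ σ τ : List Bool, τ <+: σ → R (pre (bit Y) σ.length) σ → R (pre (bit Y) τ.length) τ)
    (hinf : ∀ n, ∃ σ : List Bool, σ.length = n ∧ R (pre (bit Y) n) σ) :
    ∃ P : ℕ → Bool, ComputableIn {chi X} P ∧ ∀ n, R (pre (bit Y) n) (pre P n) := by
  classical
  obtain ⟨P, hP, hpath⟩ := h {σ | R (pre (bit Y) σ.length) σ} (fun σ hσ τ hτ => htree σ τ hτ hσ)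
    (by
      refine Set.infinite_of_not_bddAbove (α := ℕ) (s := List.length '' _) ?_ |>.of_image _
      rintro ⟨N, hN⟩
      obtain ⟨σ, hσ, hRσ⟩ := hinf (N + 1)
      have := hN ⟨σ, show R _ _ by rwa [hσ], rfl⟩
      omega)
    (by
      have hd : Primrec₂ fun τ σ => decide (R τ σ) := primrecRel_iff_primrec_decide.1 hR
      have := computableIn_pre Y hd (Primrec.list_length (α := Bool))
      convert this using 1
      funext σ
      exact decide_eq_decide.2 Iff.rfl)
  refine ⟨P, hP, fun n => ?_⟩
  have : R (pre (bit Y) (pre P n).length) (pre P n) := hpath n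
  rwa [length_pre] at this

/-- The initial segments of `Y` form a tree whose only path is `Y` itself. -/
theorem PAOver.computableFrom {X Y : Set ℕ} (h : PAOver X Y) : ComputableFrom Y X := by
  obtain ⟨P, hP, hpath⟩ := h.exists_path (R := fun τ σ => τ = σ) Primrec.eq
    (fun σ τ hτ hσ => by
      rw [← hσ] at hτ
      exact (eq_pre_of_prefix hτ).symm)
    (fun n => ⟨_, length_pre _ _, rfl⟩)
  have hY : Y = {j | P (id j) = true} := by
    ext j
    have := congrArg (·[j]?) (hpath (j + 1))
    simp only [getElem?_pre, Nat.lt_succ_self, if_true, Option.some_inj] at this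
    simp [← this]
  rw [hY]
  exact computableFrom_setOf hP Primrec.id

end StableRamsey

namespace StableRamsey

open Nat.Partrec (Code)

/-! ### Diagonally noncomputable sets -/

/-- The computation with index `j = ⟨e, n⟩` and time and oracle bounds coded by `s`, relative to
the finite oracle `τ`. -/
def oracleEval (j : ℕ) (τ : List Bool) (s : ℕ) : Option ℕ :=
  Code.evaln s.unpair.1 (Denumerable.ofNat Code j.unpair.1)
    (Encodable.encode (τ.take s.unpair.2, j.unpair.2))

/-- The first halting computation with index `j` relative to `τ` outputs `b`. -/
def Outputs (τ : List Bool) (j : ℕ) (b : Bool) : Prop :=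
  ∃ s < τ.length + 1, oracleEval j τ s = some b.toNat ∧ ∀ s' < s, oracleEval j τ s' = none

/-- `V` is diagonally noncomputable relative to `O`. -/
def DNC (V O : Set ℕ) : Prop :=
  ∀ s j b, Outputs (pre (bit O) s) j b → bit V j ≠ b

theorem primrec_oracleEval :
    Primrec fun p : (ℕ × List Bool) × ℕ => oracleEval p.1.1 p.1.2 p.2 := by
  refine Code.primrec_evaln.comp (Primrec.pair (Primrec.pair
    (Primrec.fst.comp (Primrec.unpair.comp Primrec.snd)) ((Primrec.ofNat Code).comp
    (Primrec.fst.comp (Primrec.unpair.comp (Primrec.fst.comp Primrec.fst)))))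
    (Primrec.encode.comp (Primrec.pair (Primrec.list_take.comp
      (Primrec.snd.comp (Primrec.unpair.comp Primrec.snd)) (Primrec.snd.comp Primrec.fst))
      (Primrec.snd.comp (Primrec.unpair.comp (Primrec.fst.comp Primrec.fst))))))

theorem primrecPred_outputs (b : Bool) :
    PrimrecPred fun p : List Bool × ℕ => Outputs p.1 p.2 b := by
  refine primrecPred_bex_lt (Primrec.succ.comp (Primrec.list_length.comp Primrec.fst))
    (PrimrecPred.and ?_ (primrecPred_ball_lt Primrec.snd ?_))
  · exact Primrec.eq.comp (primrec_oracleEval.comp (Primrec.pair (Primrec.pair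
      (Primrec.snd.comp Primrec.fst) (Primrec.fst.comp Primrec.fst)) Primrec.snd))
      (Primrec.const _)
  · refine Primrec.eq.comp (primrec_oracleEval.comp (Primrec.pair (Primrec.pair
      (Primrec.snd.comp (Primrec.fst.comp Primrec.fst))
      (Primrec.fst.comp (Primrec.fst.comp Primrec.fst))) Primrec.snd)) (Primrec.const _)

/-- Stage `s` consults at most `s.unpair.2 ≤ s` oracle bits. So the stages up to `τ.length` are
settled by `τ`, and the first halting stage never changes later. -/
theorem oracleEval_of_prefix {τ τ' : List Bool} (h : τ <+: τ') {j s : ℕ} (hs : s ≤ τ.length) :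
    oracleEval j τ' s = oracleEval j τ s := by
  have h2 : s.unpair.2 ≤ τ.length := (Nat.unpair_right_le s).trans hs
  obtain ⟨ρ, rfl⟩ := h
  rw [oracleEval, oracleEval, List.take_append_of_le_length h2]

theorem Outputs.mono {τ τ' : List Bool} (h : τ <+: τ') {j : ℕ} {b : Bool} (hb : Outputs τ j b) :
    Outputs τ' j b := by
  obtain ⟨s, hs, h1, h2⟩ := hb
  refine ⟨s, hs.trans_le (by have := h.length_le; omega), ?_, fun s' hs' => ?_⟩
  · rwa [oracleEval_of_prefix h (by omega)]
  · rw [oracleEval_of_prefix h (by omega)]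
    exact h2 s' hs'

theorem Outputs.unique {τ : List Bool} {j : ℕ} {b b' : Bool} (h : Outputs τ j b)
    (h' : Outputs τ j b') : b = b' := by
  obtain ⟨s, hs, h1, h2⟩ := h
  obtain ⟨s', hs', h1', h2'⟩ := h'
  have : s = s' := by
    rcases lt_trichotomy s s' with hlt | heq | hlt
    · simp [h2' s hlt] at h1
    · exact heq
    · simp [h2 s' hlt] at h1'
  subst this
  rw [h1, Option.some_inj] at h1'
  cases b <;> cases b' <;> simp_all

/-- Outputs are unique, so answering `true` exactly where the output is `false` always disagrees
with it. -/
theorem exists_dnc (O : Set ℕ) : ∃ V, DNC V O := by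
  refine ⟨{j | ∃ s, Outputs (pre (bit O) s) j false}, fun s j b hb hV => ?_⟩
  cases b with
  | false =>
    rw [bit_eq_false] at hV
    exact hV ⟨s, hb⟩
  | true =>
    rw [bit_eq_true] at hV
    obtain ⟨t, ht⟩ := hV
    have := (hb.mono (pre_prefix _ (le_max_left s t))).unique
      (ht.mono (pre_prefix _ (le_max_right s t)))
    cases this

/-! ### Diagonally noncomputable sets have PA degree -/

/-- The strings `σ₀ = []`, `σₙ₊₁ = σₙ ++ [V ⟨e, σₙ⟩]`. -/
def node (V : ℕ → Bool) (e : ℕ) (n : ℕ) : List Bool :=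
  n.rec [] fun _ σ => σ ++ [V (Nat.pair e (Encodable.encode σ))]

/-- The computation of `node` from a finite part of `V`. -/
def nodeApprox (e : ℕ) (τ : List Bool) (n : ℕ) : Option (List Bool) :=
  n.rec (some []) fun _ IH => IH.bind fun σ =>
    (τ[Nat.pair e (Encodable.encode σ)]?).map fun b => σ ++ [b]

theorem primrec_nodeApprox (e : ℕ) : Primrec₂ (nodeApprox e) := by
  refine Primrec.nat_rec' Primrec.snd (Primrec.const (some []))
    (h := fun (p : List Bool × ℕ) (q : ℕ × Option (List Bool)) => q.2.bind fun σ =>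
      (p.1[Nat.pair e (Encodable.encode σ)]?).map fun b => σ ++ [b]) (Primrec₂.mk ?_)
  refine Primrec.option_bind (Primrec.snd.comp Primrec.snd) (Primrec₂.mk ?_)
  refine Primrec.option_map (Primrec.list_getElem?.comp
    (Primrec.fst.comp (Primrec.fst.comp Primrec.fst)) (Primrec₂.natPair.comp (Primrec.const e)
    (Primrec.encode.comp Primrec.snd))) (Primrec₂.mk ?_)
  exact Primrec.list_concat.comp (Primrec.snd.comp Primrec.fst) Primrec.snd

theorem node_succ (V : ℕ → Bool) (e n : ℕ) :
    node V e (n + 1) = node V e n ++ [V (Nat.pair e (Encodable.encode (node V e n)))] := rfl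

theorem nodeApprox_succ (e : ℕ) (τ : List Bool) (n : ℕ) :
    nodeApprox e τ (n + 1) = (nodeApprox e τ n).bind fun σ =>
      (τ[Nat.pair e (Encodable.encode σ)]?).map fun b => σ ++ [b] := rfl

theorem nodeApprox_sound {V : ℕ → Bool} {e s n : ℕ} {σ : List Bool}
    (h : nodeApprox e (pre V s) n = some σ) : σ = node V e n := by
  induction n generalizing σ with
  | zero => simpa [nodeApprox, node, eq_comm] using h
  | succ n ih =>
    simp only [nodeApprox_succ, Option.bind_eq_some_iff, Option.map_eq_some_iff,
      getElem?_pre] at h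
    obtain ⟨ρ, hρ, b, hb, rfl⟩ := h
    obtain rfl := ih hρ
    split_ifs at hb
    rw [node_succ, Option.some_inj.1 hb]

theorem exists_nodeApprox (V : ℕ → Bool) (e n : ℕ) :
    ∃ t, ∀ s ≥ t, nodeApprox e (pre V s) n = some (node V e n) := by
  induction n with
  | zero => exact ⟨0, fun _ _ => rfl⟩
  | succ n ih =>
    obtain ⟨t, ht⟩ := ih
    refine ⟨max t (Nat.pair e (Encodable.encode (node V e n)) + 1), fun s hs => ?_⟩
    rw [ge_iff_le, max_le_iff] at hs
    rw [nodeApprox_succ, ht s hs.1, Option.bind_some, getElem?_pre, if_pos (by omega),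
      Option.map_some, node_succ]

theorem computableIn_path (V : Set ℕ) (e : ℕ) :
    ComputableIn {chi V} fun n => bit V (Nat.pair e (Encodable.encode (node (bit V) e n))) := by
  refine Approximates.recursiveIn (φ := fun τ n => (nodeApprox e τ n).bind fun σ =>
    τ[Nat.pair e (Encodable.encode σ)]?) ?_ fun n b => ?_
  · refine Primrec.option_bind (primrec_nodeApprox e) (Primrec₂.mk ?_)
    exact Primrec.list_getElem?.comp (Primrec.fst.comp Primrec.fst) (Primrec₂.natPair.comp
      (Primrec.const e) (Primrec.encode.comp Primrec.snd))
  · simp only [Part.mem_some_iff, Option.bind_eq_some_iff, getElem?_pre]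
    constructor
    · rintro rfl
      obtain ⟨t, ht⟩ := exists_nodeApprox (bit V) e n
      refine ⟨max t (Nat.pair e (Encodable.encode (node (bit V) e n)) + 1), _,
        ht _ (le_max_left _ _), ?_⟩
      rw [if_pos (lt_of_lt_of_le (Nat.lt_succ_self _) (le_max_right _ _))]
    · rintro ⟨s, σ, hσ, hb⟩
      obtain rfl := nodeApprox_sound hσ
      split_ifs at hb
      exact (Option.some_inj.1 hb).symm

theorem pre_path (V : ℕ → Bool) (e n : ℕ) :
    pre (fun n => V (Nat.pair e (Encodable.encode (node V e n)))) n = node V e n := by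
  induction n with
  | zero => simp [pre, node]
  | succ n ih => rw [pre_succ, ih, node_succ]

/-- By stage `τ`, the approximation `φ` to a tree shows that `σ ++ [b]` has no extension of some
length. -/
def Dead (φ : List Bool → List Bool → Option Bool) (b : Bool) (τ σ : List Bool) : Prop :=
  ∃ l < τ.length + 1, ∀ ρ ∈ boolLists l, ρ.length = l → φ τ (σ ++ b :: ρ) = some false

theorem primrecPred_dead {φ : List Bool → List Bool → Option Bool} (hφ : Primrec₂ φ) (b : Bool) :
    PrimrecPred fun p : List Bool × List Bool => Dead φ b p.1 p.2 := by
  refine primrecPred_bex_lt (Primrec.succ.comp (Primrec.list_length.comp Primrec.fst))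
    (primrecPred_ball_mem (primrec_boolLists.comp Primrec.snd) (primrecPred_imp ?_ ?_))
  · exact Primrec.eq.comp (Primrec.list_length.comp Primrec.snd) (Primrec.snd.comp Primrec.fst)
  · refine Primrec.eq.comp (hφ.comp (Primrec.fst.comp (Primrec.fst.comp Primrec.fst))
      (Primrec.list_append.comp (Primrec.snd.comp (Primrec.fst.comp Primrec.fst))
      (Primrec.list_cons.comp (Primrec.const b) Primrec.snd))) (Primrec.const _)

theorem exists_code {g : List Bool × ℕ → Option ℕ} (hg : Primrec g) :
    ∃ e : Code, ∀ p v, v ∈ e.eval (Encodable.encode p) ↔ g p = some v := by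
  have h : Partrec fun p => (g p : Part ℕ) := Computable.ofOption hg.to_comp
  obtain ⟨e, he⟩ := Code.exists_code.1 h
  refine ⟨e, fun p v => ?_⟩
  rw [he]
  simp

/-- The oracle string is part of the input of `e`, so different prefixes of `O` give separate
computations. Whichever halts first, its value is `b`, because every defined value along `O` is `b`;
no monotonicity of `g` is needed. -/
theorem Outputs.of_eventually {g : List Bool × ℕ → Option ℕ} {e : Code}
    (he : ∀ p v, v ∈ e.eval (Encodable.encode p) ↔ g p = some v) {O : ℕ → Bool} {n t : ℕ} {b : Bool}
    (h1 : g (pre O t, n) = some b.toNat) (h2 : ∀ s v, g (pre O s, n) = some v → v = b.toNat) :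
    ∃ s, Outputs (pre O s) (Nat.pair (Encodable.encode e) n) b := by
  classical
  obtain ⟨k, hk⟩ := Code.evaln_complete.1 ((he _ _).2 h1)
  have hE : ∀ S s, s ≤ S → oracleEval (Nat.pair (Encodable.encode e) n) (pre O S) s =
      Code.evaln s.unpair.1 e (Encodable.encode (pre O s.unpair.2, n)) := by
    intro S s hs
    have : s.unpair.2 ≤ S := (Nat.unpair_right_le s).trans hs
    simp [oracleEval, take_pre, this]
  have hex : ∃ s, (oracleEval (Nat.pair (Encodable.encode e) n)
      (pre O (Nat.pair k t)) s).isSome ∧ s ≤ Nat.pair k t := by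
    refine ⟨Nat.pair k t, ?_, le_rfl⟩
    rw [hE _ _ le_rfl, Nat.unpair_pair]
    exact Option.isSome_iff_exists.2 ⟨_, hk⟩
  obtain ⟨hs1, hs2⟩ := Nat.find_spec hex
  refine ⟨Nat.pair k t, Nat.find hex, by rw [length_pre]; omega, ?_, fun s' hs' => ?_⟩
  · obtain ⟨v, hv⟩ := Option.isSome_iff_exists.1 hs1
    rw [hv]
    rw [hE _ _ hs2] at hv
    rw [h2 _ _ ((he _ _).1 (Code.evaln_sound hv))]
  · have := Nat.find_min hex hs'
    rw [not_and_or, Option.not_isSome_iff_eq_none] at this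
    exact this.resolve_right (by omega)

/-- A single program, given a node `σ`, waits for one child of `σ` to be seen to have no extensions
of some length and outputs that child. If `σ` is extendible to all lengths, at most one child ever
dies. The answer of `V` differs from the output, so following `V` never enters a dead child, and the
nodes visited form a path. -/
theorem DNC.paOver {V O : Set ℕ} (hV : DNC V O) : PAOver V O := by
  classical
  intro T hT hinf hc
  obtain ⟨φ, hφ, hmono, happ⟩ := exists_approx hc
  have hmem : ∀ σ b, b = decide (σ ∈ T) ↔ ∃ s, φ (pre (bit O) s) σ = some b := by
    intro σ b
    rw [← happ, Part.mem_some_iff]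
  have hfalse : ∀ σ s, φ (pre (bit O) s) σ = some false → σ ∉ T := by
    intro σ s hs
    simpa using (hmem σ false).2 ⟨s, hs⟩
  let g : List Bool × ℕ → Option ℕ := fun p =>
    (Encodable.decode (α := List Bool) p.2).bind fun σ =>
      if Dead φ false p.1 σ then some 0 else if Dead φ true p.1 σ then some 1 else none
  have hg : Primrec g := by
    have hd : ∀ b, PrimrecPred fun p : (List Bool × ℕ) × List Bool => Dead φ b p.1.1 p.2 := fun b =>
      (primrecPred_dead hφ b).comp (Primrec.pair (Primrec.fst.comp Primrec.fst) Primrec.snd)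
    refine Primrec.option_bind (Primrec.decode.comp Primrec.snd) (Primrec₂.mk ?_)
    exact Primrec.ite (hd _) (Primrec.const _) (Primrec.ite (hd _) (Primrec.const _)
      (Primrec.const _))
  obtain ⟨e, he⟩ := exists_code hg
  let P : ℕ → Bool := fun n =>
    bit V (Nat.pair (Encodable.encode e) (Encodable.encode (node (bit V) (Encodable.encode e) n)))
  refine ⟨P, computableIn_path V _, ?_⟩
  -- `σ` is extendible to arbitrary lengths
  let Ext : List Bool → Prop := fun σ => ∀ l, ∃ ρ : List Bool, ρ.length = l ∧ σ ++ ρ ∈ T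
  have hnil : Ext [] := by
    intro l
    obtain ⟨ρ, hρ, hl⟩ := hinf.exists_notMem_finite (List.finite_length_lt Bool l)
    refine ⟨ρ.take l, ?_, hT ρ hρ _ (List.take_prefix _ _)⟩
    have : l ≤ ρ.length := by simpa using hl
    simp [this]
  have hdead : ∀ σ b s, Dead φ b (pre (bit O) s) σ → ¬ Ext (σ ++ [b]) := by
    rintro σ b s ⟨l, -, hl⟩ hE
    obtain ⟨ρ, hρ, hm⟩ := hE l
    exact hfalse _ s (hl ρ (mem_boolLists.2 hρ.le) hρ) (by simpa using hm)
  -- If the children failed at lengths `l'` and `l`, an extension of `σ` by `l + l' + 1` bits would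
  -- pass through one of them and contradict its failure.
  have hext : ∀ σ b, Ext σ → ¬ Ext (σ ++ [b]) → Ext (σ ++ [!b]) := by
    intro σ b h1 h2 l
    by_contra hcon
    simp only [Ext, not_forall, not_exists, not_and] at h2 hcon
    obtain ⟨l', hl'⟩ := h2
    obtain ⟨ρ, hρ, hm⟩ := h1 (l + l' + 1)
    rcases ρ with _ | ⟨a, ρ⟩
    · simp at hρ
    have hρ' : ρ.length = l + l' := by simpa using hρ
    by_cases hab : a = b
    · subst hab
      refine hl' (ρ.take l') (by simp [hρ']) (hT _ hm _ ?_)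
      rw [List.append_assoc, List.singleton_append]
      exact (List.prefix_append_right_inj _).2 ((List.cons_prefix_cons).2
        ⟨rfl, List.take_prefix _ _⟩)
    · have : a = !b := by cases a <;> cases b <;> simp_all
      subst this
      refine hcon (ρ.take l) (by simp [hρ']) (hT _ hm _ ?_)
      rw [List.append_assoc, List.singleton_append]
      exact (List.prefix_append_right_inj _).2 ((List.cons_prefix_cons).2
        ⟨rfl, List.take_prefix _ _⟩)
  have hstage : ∀ σ b, ¬ Ext (σ ++ [b]) → ∃ t, Dead φ b (pre (bit O) t) σ := by
    intro σ b h
    simp only [Ext, not_forall, not_exists, not_and] at h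
    obtain ⟨l, hl⟩ := h
    have : ∀ ρ : List Bool, ∃ t, ρ.length = l → φ (pre (bit O) t) (σ ++ b :: ρ) = some false := by
      intro ρ
      by_cases hρ : ρ.length = l
      · have := hl ρ hρ
        rw [List.append_assoc, List.singleton_append] at this
        obtain ⟨t, ht⟩ := (hmem (σ ++ b :: ρ) false).1 (by simpa using this)
        exact ⟨t, fun _ => ht⟩
      · exact ⟨0, fun h => absurd h hρ⟩
    choose t ht using this
    refine ⟨max l ((boolLists l).toFinset.sup t), l, by rw [length_pre]; omega, fun ρ hρ h => ?_⟩
    exact hmono.pre (le_max_of_le_right (Finset.le_sup (f := t) (List.mem_toFinset.2 hρ))) (ht ρ h)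
  have hstep : ∀ σ, Ext σ →
      Ext (σ ++ [bit V (Nat.pair (Encodable.encode e) (Encodable.encode σ))]) := by
    intro σ hσ
    by_contra hcon
    set b := bit V (Nat.pair (Encodable.encode e) (Encodable.encode σ)) with hb
    -- The other child is extendible, hence never declared dead. The order in which `g` tests the
    -- two children is therefore irrelevant, and its only possible output is `b`.
    have hnd : ∀ s, ¬ Dead φ (!b) (pre (bit O) s) σ := fun s hs => hdead _ _ _ hs (hext _ _ hσ hcon)
    have hgσ : ∀ s, g (pre (bit O) s, Encodable.encode σ) =
        if Dead φ b (pre (bit O) s) σ then some b.toNat else none := by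
      intro s
      have := hnd s
      simp only [g, Encodable.encodek, Option.bind_some]
      cases hb' : b <;> rw [hb'] at this <;> simp only [Bool.not_true, Bool.not_false] at this <;>
        simp [this]
    obtain ⟨t, ht⟩ := hstage σ b hcon
    obtain ⟨s, hs⟩ := Outputs.of_eventually he (b := b) (O := bit O) (n := Encodable.encode σ)
      (t := t) (by rw [hgσ, if_pos ht]) (fun s v hv => by
        rw [hgσ] at hv
        split_ifs at hv
        exact (Option.some_inj.1 hv).symm)
    exact hV _ _ _ hs hb.symm
  have hnode : ∀ n, Ext (node (bit V) (Encodable.encode e) n) := by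
    intro n
    induction n with
    | zero => exact hnil
    | succ n ih => exact hstep _ ih
  intro n
  change pre P n ∈ T
  rw [pre_path]
  obtain ⟨ρ, -, hρ⟩ := hnode n 0
  exact hT _ hρ _ (List.prefix_append _ _)

/-! ### Density of the relation of having PA degree -/

/-- No output relative to `ι` of a computation with index below `|ρ|` is predicted by `ρ`. -/
def Avoids (ι ρ : List Bool) : Prop :=
  ∀ j < ρ.length, (Outputs ι j true → ρ[j]? ≠ some true) ∧ (Outputs ι j false → ρ[j]? ≠ some false)

theorem avoids_iff {ι ρ : List Bool} :
    Avoids ι ρ ↔ ∀ j b, Outputs ι j b → ρ[j]? ≠ some b := by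
  constructor
  · intro h j b hb
    by_cases hj : j < ρ.length
    · cases b
      · exact (h j hj).2 hb
      · exact (h j hj).1 hb
    · simp [List.getElem?_eq_none (not_lt.1 hj)]
  · exact fun h j _ => ⟨h j true, h j false⟩

theorem primrecRel_avoids : PrimrecRel Avoids := by
  have hj : ∀ b, PrimrecPred fun p : (List Bool × List Bool) × ℕ => p.1.2[p.2]? = some b :=
    fun b => Primrec.eq.comp (Primrec.list_getElem?.comp (Primrec.snd.comp Primrec.fst) Primrec.snd)
      (Primrec.const _)
  have ho : ∀ b, PrimrecPred fun p : (List Bool × List Bool) × ℕ => Outputs p.1.1 p.2 b :=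
    fun b => (primrecPred_outputs b).comp (Primrec.pair (Primrec.fst.comp Primrec.fst) Primrec.snd)
  exact primrecPred_ball_lt (Primrec.list_length.comp Primrec.snd)
    ((primrecPred_imp (ho _) (hj _).not).and (primrecPred_imp (ho _) (hj _).not))

theorem Avoids.of_prefix {ι ι' ρ ρ' : List Bool} (h : Avoids ι' ρ') (hι : ι <+: ι')
    (hρ : ρ <+: ρ') : Avoids ι ρ := by
  rw [avoids_iff] at h ⊢
  exact fun j b hb hj => h j b (hb.mono hι) (getElem?_of_prefix hρ hj)

theorem DNC.avoids {V O : Set ℕ} (h : DNC V O) (s t : ℕ) :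
    Avoids (pre (bit O) s) (pre (bit V) t) := by
  rw [avoids_iff]
  intro j b hb hj
  rw [getElem?_pre] at hj
  split_ifs at hj
  exact h s j b hb (Option.some_inj.1 hj)

theorem DNC.of_avoids {V O : Set ℕ} (h : ∀ n, Avoids (pre (bit O) n) (pre (bit V) n)) :
    DNC V O := by
  intro s j b hb hj
  refine avoids_iff.1 (h (max s (j + 1))) j b (hb.mono (pre_prefix _ (le_max_left _ _))) ?_
  rw [getElem?_pre, if_pos (lt_of_lt_of_le (Nat.lt_succ_self _) (le_max_right _ _)), hj]

/-! ### Splitting a string into the two halves of a join -/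

/-- The entries of `σ` with even index. -/
def evens (σ : List Bool) : List Bool :=
  (List.range ((σ.length + 1) / 2)).map fun i => σ.getD (2 * i) false

/-- The entries of `σ` with odd index. -/
def odds (σ : List Bool) : List Bool :=
  (List.range (σ.length / 2)).map fun i => σ.getD (2 * i + 1) false

theorem primrec_evens : Primrec evens :=
  Primrec.list_map (Primrec.list_range.comp (Primrec.nat_div.comp (Primrec.succ.comp
    Primrec.list_length) (Primrec.const 2))) (Primrec₂.mk ((Primrec.list_getD false).comp
    Primrec.fst (Primrec.nat_double.comp Primrec.snd)))

theorem primrec_odds : Primrec odds :=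
  Primrec.list_map (Primrec.list_range.comp (Primrec.nat_div.comp
    Primrec.list_length (Primrec.const 2))) (Primrec₂.mk ((Primrec.list_getD false).comp
    Primrec.fst (Primrec.nat_double_succ.comp Primrec.snd)))

theorem evens_pre (P : ℕ → Bool) (n : ℕ) :
    evens (pre P n) = pre (fun i => P (2 * i)) ((n + 1) / 2) := by
  apply List.ext_getElem?
  intro i
  simp only [evens, length_pre, List.getElem?_map, getElem?_pre,
    List.getD_eq_getElem?_getD]
  by_cases h : i < (n + 1) / 2
  · have : 2 * i < n := by omega
    simp [h, this]
  · simp [h]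

theorem odds_pre (P : ℕ → Bool) (n : ℕ) :
    odds (pre P n) = pre (fun i => P (2 * i + 1)) (n / 2) := by
  apply List.ext_getElem?
  intro i
  simp only [odds, length_pre, List.getElem?_map, getElem?_pre,
    List.getD_eq_getElem?_getD]
  by_cases h : i < n / 2
  · have : 2 * i + 1 < n := by omega
    simp [h, this]
  · simp [h]

theorem map_range_prefix {β : Type*} {f g : ℕ → β} {m n : ℕ} (hmn : m ≤ n)
    (hfg : ∀ i < m, f i = g i) : (List.range m).map f <+: (List.range n).map g := by
  rw [List.prefix_iff_eq_take, ← List.map_take, List.take_range]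
  simp only [List.length_map, List.length_range, min_eq_left hmn]
  exact List.map_congr_left fun i hi => hfg i (List.mem_range.1 hi)

theorem getD_of_prefix {σ τ : List Bool} (h : τ <+: σ) {i : ℕ} (hi : i < τ.length) :
    τ.getD i false = σ.getD i false := by
  obtain ⟨ρ, rfl⟩ := h
  rw [List.getD_append _ _ _ _ hi]

theorem evens_prefix {σ τ : List Bool} (h : τ <+: σ) : evens τ <+: evens σ :=
  map_range_prefix (by have := h.length_le; omega) fun i hi => getD_of_prefix h (by omega)

theorem odds_prefix {σ τ : List Bool} (h : τ <+: σ) : odds τ <+: odds σ :=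
  map_range_prefix (by have := h.length_le; omega) fun i hi => getD_of_prefix h (by omega)

theorem bit_setOf (P : ℕ → Bool) : bit {j | P j = true} = P := by
  funext j
  rw [Bool.eq_iff_iff]
  simp

/-- The relation of having PA degree is dense. -/
theorem PAOver.exists_between {X Y : Set ℕ} (h : PAOver X Y) :
    ∃ Z, PAOver Z Y ∧ PAOver X Z := by
  -- The tree approximates joins `Z ⊕ V` with `Z` diagonally noncomputable over `Y` and `V` over
  -- `Z`. A path computed by `X` yields both sets, and `V ≤ X` gives `Z ≪ X`.
  obtain ⟨P, hP, hpath⟩ := h.exists_path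
    (R := fun ι σ => Avoids ι (evens σ) ∧ Avoids (evens σ) (odds σ))
    (PrimrecPred.and (primrecRel_avoids.comp Primrec.fst (primrec_evens.comp Primrec.snd))
      (primrecRel_avoids.comp (primrec_evens.comp Primrec.snd) (primrec_odds.comp Primrec.snd)))
    (fun σ τ hτ hσ => ⟨hσ.1.of_prefix (pre_prefix _ hτ.length_le) (evens_prefix hτ),
      hσ.2.of_prefix (evens_prefix hτ) (odds_prefix hτ)⟩)
    (fun n => by
      obtain ⟨Z, hZ⟩ := exists_dnc Y
      obtain ⟨V, hV⟩ := exists_dnc Z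
      let Q : ℕ → Bool := fun i => if i % 2 = 0 then bit Z (i / 2) else bit V (i / 2)
      have hQ0 : (fun i => Q (2 * i)) = bit Z := by
        funext i
        simp [Q]
      have hQ1 : (fun i => Q (2 * i + 1)) = bit V := by
        funext i
        have h1 : (2 * i + 1) % 2 = 1 := by omega
        have h2 : (2 * i + 1) / 2 = i := by omega
        simp [Q, h1, h2]
      refine ⟨pre Q n, length_pre _ _, ?_⟩
      rw [evens_pre, odds_pre, hQ0, hQ1]
      exact ⟨hZ.avoids _ _, hV.avoids _ _⟩)
  have hpath' : ∀ n, Avoids (pre (bit Y) (2 * n)) (pre (fun i => P (2 * i)) n) ∧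
      Avoids (pre (fun i => P (2 * i)) n) (pre (fun i => P (2 * i + 1)) n) := by
    intro n
    have := hpath (2 * n)
    rwa [evens_pre, odds_pre, show (2 * n + 1) / 2 = n by omega, show 2 * n / 2 = n by omega]
      at this
  refine ⟨{j | P (2 * j) = true}, (DNC.of_avoids fun n => ?_).paOver,
    PAOver.mono_left (X := {j | P (2 * j + 1) = true}) (DNC.of_avoids fun n => ?_).paOver
      (computableFrom_setOf hP Primrec.nat_double_succ)⟩
  · rw [bit_setOf (fun j => P (2 * j))]
    exact (hpath' n).1.of_prefix (pre_prefix _ (by omega)) List.prefix_rfl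
  · rw [bit_setOf (fun j => P (2 * j)), bit_setOf (fun j => P (2 * j + 1))]
    exact (hpath' n).2

end StableRamsey

namespace StableRamsey

/-! ### Computable restrictions of reservoirs -/

theorem ComputableFrom.inter {A B Z : Set ℕ} (hA : ComputableFrom A Z) (hB : ComputableFrom B Z) :
    ComputableFrom (A ∩ B) Z := by
  obtain ⟨φ, p1, m1, a1⟩ := exists_approx hA
  obtain ⟨ψ, p2, m2, a2⟩ := exists_approx hB
  refine Approximates.recursiveIn
    (φ := fun τ n => (φ τ n).bind fun a => (ψ τ n).map fun b => a * b) ?_ fun n v => ?_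
  · refine Primrec.option_bind p1 (Primrec₂.mk (Primrec.option_map
      (p2.comp (Primrec.fst.comp Primrec.fst) (Primrec.snd.comp Primrec.fst)) (Primrec₂.mk ?_)))
    exact Primrec.nat_mul.comp (Primrec.snd.comp Primrec.fst) Primrec.snd
  · have hbit : (bit (A ∩ B) n).toNat = (bit A n).toNat * (bit B n).toNat := by
      by_cases h1 : n ∈ A <;> by_cases h2 : n ∈ B <;> simp [bit, h1, h2]
    have b1 := a1 n
    have b2 := a2 n
    simp only [chi_eq, Part.mem_some_iff] at b1 b2
    simp only [chi_eq, hbit, Part.mem_some_iff, Option.bind_eq_some_iff, Option.map_eq_some_iff]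
    constructor
    · rintro rfl
      obtain ⟨s, hs⟩ := (b1 _).1 rfl
      obtain ⟨t, ht⟩ := (b2 _).1 rfl
      exact ⟨max s t, _, m1.pre (le_max_left _ _) hs, _, m2.pre (le_max_right _ _) ht, rfl⟩
    · rintro ⟨s, a, ha, b, hb, rfl⟩
      rw [(b1 a).2 ⟨s, ha⟩, (b2 b).2 ⟨s, hb⟩]

theorem computableFrom_Ici (m : ℕ) (Z : Set ℕ) : ComputableFrom (Set.Ici m) Z := by
  have h : Primrec fun n => decide (m ≤ n) :=
    (Primrec.nat_le.comp (Primrec.const m) Primrec.id).decide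
  convert computableFrom_setOf (X := Z) h.computableIn Primrec.id using 1
  ext n
  simp

theorem PAOver.inter_Ici {X I : Set ℕ} (h : PAOver X I) (m : ℕ) : PAOver X (I ∩ Set.Ici m) :=
  h.mono_right ((ComputableFrom.refl I).inter (computableFrom_Ici m I))

theorem infinite_inter_Ici {I : Set ℕ} (h : I.Infinite) (m : ℕ) : (I ∩ Set.Ici m).Infinite := by
  have : I ∩ Set.Ici m = I \ Set.Iio m := by
    ext n
    simp
  rw [this]
  exact h.sdiff (Set.finite_Iio m)

/-! ### Finite covers of a reservoir and splittings -/

section Finite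

variable {k : ℕ}

/-- The string `σ`, read as a sequence of blocks of length `k`, assigns one of `k` parts to each
element of `ι` for which it is long enough. -/
def Covers (k : ℕ) (ι σ : List Bool) : Prop :=
  ∀ x < σ.length, k * x + k ≤ σ.length → ι[x]? = some true → ∃ i : Fin k,
    σ[k * x + i]? = some true

/-- The finite set `τ` consists of `F` and elements of the `i`th part of `σ` inside `ι`. -/
def Fits (k : ℕ) (F : Finset ℕ) (i : ℕ) (ι σ τ : List Bool) : Prop :=
  ∀ x < τ.length, (x ∈ F → τ[x]? = some true) ∧
    (τ[x]? = some true → x ∈ F ∨ (ι[x]? = some true ∧ σ[k * x + i]? = some true))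

/-- For some part of `σ`, a finite set extending `F` inside that part makes `φ` accept a pair of
numbers satisfying `R`. -/
def Splits (F : Fin k → Finset ℕ) (φ : Fin k → List Bool → ℕ → Option ℕ) (R : ℕ → ℕ → Prop)
    (ι σ : List Bool) : Prop :=
  ∃ i : Fin k, ∃ τ ∈ boolLists σ.length, Fits k (F i) i ι σ τ ∧
    ∃ x < σ.length, ∃ y < σ.length, x < y ∧ R x y ∧ φ i τ x = some 1 ∧ φ i τ y = some 1

theorem Covers.of_prefix {ι ι' σ σ' : List Bool} (h : Covers k ι' σ') (hι : ι <+: ι')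
    (hσ : σ <+: σ') : Covers k ι σ := by
  intro x hx hk hxι
  have hl := hσ.length_le
  obtain ⟨i, hi⟩ := h x (by omega) (by omega) (getElem?_of_prefix hι hxι)
  refine ⟨i, ?_⟩
  obtain ⟨ρ, rfl⟩ := hσ
  have := i.2
  rwa [List.getElem?_append_left (by omega)] at hi

/-- Splitting persists under extension, while covering passes to initial segments. So the covers
that do not split form a tree. -/
theorem Splits.of_prefix {F : Fin k → Finset ℕ} {φ : Fin k → List Bool → ℕ → Option ℕ}
    {R : ℕ → ℕ → Prop} {ι ι' σ σ' : List Bool} (h : Splits F φ R ι σ) (hι : ι <+: ι')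
    (hσ : σ <+: σ') : Splits F φ R ι' σ' := by
  obtain ⟨i, τ, hτ, hfit, x, hx, y, hy, hrest⟩ := h
  have hl := hσ.length_le
  refine ⟨i, τ, mem_boolLists.2 ((mem_boolLists.1 hτ).trans hl), fun z hz => ?_, x,
    by omega, y, by omega, hrest⟩
  exact ⟨(hfit z hz).1, fun h => ((hfit z hz).2 h).imp_right fun h =>
    ⟨getElem?_of_prefix hι h.1, getElem?_of_prefix hσ h.2⟩⟩

theorem Splits.mono {F : Fin k → Finset ℕ} {φ : Fin k → List Bool → ℕ → Option ℕ}
    {R R' : ℕ → ℕ → Prop} {ι σ : List Bool} (h : Splits F φ R ι σ)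
    (hR : ∀ x y, x < y → y < σ.length → R x y → R' x y) : Splits F φ R' ι σ := by
  obtain ⟨i, τ, hτ, hfit, x, hx, y, hy, hxy, hRxy, hrest⟩ := h
  exact ⟨i, τ, hτ, hfit, x, hx, y, hy, hxy, hR x y hxy hy hRxy, hrest⟩

theorem primrecRel_covers (k : ℕ) : PrimrecRel (Covers k) := by
  have hkx : Primrec fun p : (List Bool × List Bool) × ℕ => k * p.2 :=
    Primrec.nat_mul.comp (Primrec.const k) Primrec.snd
  refine primrecPred_ball_lt (Primrec.list_length.comp Primrec.snd) (primrecPred_imp ?_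
    (primrecPred_imp ?_ (primrecPred_exists_fin fun i => ?_)))
  · exact Primrec.nat_le.comp (Primrec.nat_add.comp hkx (Primrec.const k))
      (Primrec.list_length.comp (Primrec.snd.comp Primrec.fst))
  · exact Primrec.eq.comp (Primrec.list_getElem?.comp (Primrec.fst.comp Primrec.fst) Primrec.snd)
      (Primrec.const _)
  · exact Primrec.eq.comp (Primrec.list_getElem?.comp (Primrec.snd.comp Primrec.fst)
      (Primrec.nat_add.comp hkx (Primrec.const _))) (Primrec.const _)

theorem primrecPred_mem_finset (F : Finset ℕ) : PrimrecPred fun x : ℕ => x ∈ F :=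
  (primrecPred_bex_mem (p := fun x y => x = y) (Primrec.const F.toList)
    (Primrec.eq.comp Primrec.fst Primrec.snd)).of_eq fun x => by simp

theorem primrecPred_fits (k : ℕ) (F : Finset ℕ) (i : ℕ) :
    PrimrecPred fun p : (List Bool × List Bool) × List Bool => Fits k F i p.1.1 p.1.2 p.2 := by
  have hF : PrimrecPred fun p : ((List Bool × List Bool) × List Bool) × ℕ => p.2 ∈ F :=
    (primrecPred_mem_finset F).comp Primrec.snd
  have hτ : PrimrecPred fun p : ((List Bool × List Bool) × List Bool) × ℕ =>
      p.1.2[p.2]? = some true :=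
    Primrec.eq.comp (Primrec.list_getElem?.comp (Primrec.snd.comp Primrec.fst) Primrec.snd)
      (Primrec.const _)
  refine primrecPred_ball_lt (Primrec.list_length.comp Primrec.snd)
    ((primrecPred_imp hF hτ).and (primrecPred_imp hτ (hF.or (PrimrecPred.and ?_ ?_))))
  · exact Primrec.eq.comp (Primrec.list_getElem?.comp (Primrec.fst.comp (Primrec.fst.comp
      Primrec.fst)) Primrec.snd) (Primrec.const _)
  · exact Primrec.eq.comp (Primrec.list_getElem?.comp (Primrec.snd.comp (Primrec.fst.comp
      Primrec.fst)) (Primrec.nat_add.comp (Primrec.nat_mul.comp (Primrec.const k) Primrec.snd)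
      (Primrec.const i))) (Primrec.const _)

theorem primrecPred_splits {α : Type*} [Primcodable α] (F : Fin k → Finset ℕ)
    {φ : Fin k → List Bool → ℕ → Option ℕ} (hφ : ∀ i, Primrec₂ (φ i)) {R : α → ℕ → ℕ → Prop}
    (hR : PrimrecPred fun p : α × ℕ × ℕ => R p.1 p.2.1 p.2.2) :
    PrimrecPred fun p : α × List Bool × List Bool => Splits F φ (R p.1) p.2.1 p.2.2 := by
  have hlen : Primrec fun p : α × List Bool × List Bool => p.2.2.length :=
    Primrec.list_length.comp (Primrec.snd.comp Primrec.snd)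
  refine primrecPred_exists_fin fun i => primrecPred_bex_mem (primrec_boolLists.comp hlen)
    (PrimrecPred.and ((primrecPred_fits k (F i) i).comp (Primrec.pair (Primrec.snd.comp Primrec.fst)
      Primrec.snd)) (primrecPred_bex_lt (hlen.comp Primrec.fst)
      (primrecPred_bex_lt (hlen.comp (Primrec.fst.comp Primrec.fst)) ?_)))
  have hx : Primrec fun p : (((α × List Bool × List Bool) × List Bool) × ℕ) × ℕ => p.1.2 :=
    Primrec.snd.comp Primrec.fst
  have hy : Primrec fun p : (((α × List Bool × List Bool) × List Bool) × ℕ) × ℕ => p.2 :=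
    Primrec.snd
  have hτ : Primrec fun p : (((α × List Bool × List Bool) × List Bool) × ℕ) × ℕ => p.1.1.2 :=
    Primrec.snd.comp (Primrec.fst.comp Primrec.fst)
  have ha : Primrec fun p : (((α × List Bool × List Bool) × List Bool) × ℕ) × ℕ => p.1.1.1.1 :=
    Primrec.fst.comp (Primrec.fst.comp (Primrec.fst.comp Primrec.fst))
  exact (Primrec.nat_lt.comp hx hy).and ((hR.comp (Primrec.pair ha (Primrec.pair hx hy))).and
    ((Primrec.eq.comp ((hφ i).comp hτ hx) (Primrec.const _)).and
      (Primrec.eq.comp ((hφ i).comp hτ hy) (Primrec.const _))))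

end Finite

/-! ### Codes of conditions -/

/-- In the condition with the given code, the color of `(x, y)` is not the promised limit color
of `x`. -/
def Conflict (a : ℕ × List (List (Fin 2)) × List (Fin 2 × ℕ)) (x y : ℕ) : Prop :=
  ((a.2.1[y]?).bind fun r => r[x]?) ≠ (a.2.2[x]?).map Prod.fst

theorem primrecPred_conflict : PrimrecPred fun p : (ℕ × List (List (Fin 2)) × List (Fin 2 × ℕ)) ×
    ℕ × ℕ => Conflict p.1 p.2.1 p.2.2 := by
  refine (Primrec.eq.comp (Primrec.option_bind (Primrec.list_getElem?.comp (Primrec.fst.comp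
    (Primrec.snd.comp Primrec.fst)) (Primrec.snd.comp Primrec.snd)) (Primrec₂.mk ?_))
    (Primrec.option_map (Primrec.list_getElem?.comp (Primrec.snd.comp
    (Primrec.snd.comp Primrec.fst)) (Primrec.fst.comp Primrec.snd)) (Primrec₂.mk ?_))).not
  · exact Primrec.list_getElem?.comp Primrec.snd (Primrec.fst.comp (Primrec.snd.comp Primrec.fst))
  · exact Primrec.fst.comp Primrec.snd

theorem conflict_code {p : Condition} {x y : ℕ} (hxy : x < y) (hy : y < p.n) :
    Conflict p.code x y ↔ p.c ⟨(x, y), hxy.trans hy, hy, hxy⟩ ≠ (p.l ⟨x, hxy.trans hy⟩).1 := by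
  simp [Conflict, Condition.code, hxy, hy, hxy.trans hy]

/-- Only the first `p.n` bits of the reservoir are consulted, and these can be obtained from `X`.
This is how genericity is applied to statements about a reservoir. -/
theorem sigmaOne_of_primrec {X I : Set ℕ} (hI : ComputableFrom I X)
    {Q : List Bool → ℕ × List (List (Fin 2)) × List (Fin 2 × ℕ) → Prop} (hQ : PrimrecRel Q) :
    SigmaOne X {p | Q (pre (bit I) p.n) p.code} := by
  classical
  refine ⟨fun a => if Q (pre (bit I) a.1) a then Part.some 0 else Part.none,
    hI.recursiveIn (Approximates.recursiveIn (φ := fun τ a =>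
      if a.1 ≤ τ.length ∧ Q (τ.take a.1) a then some 0 else none) ?_ fun a b => ?_), fun p => ?_⟩
  · refine Primrec.ite (PrimrecPred.and ?_ ?_) (Primrec.const _) (Primrec.const _)
    · exact Primrec.nat_le.comp (Primrec.fst.comp Primrec.snd) (Primrec.list_length.comp
        Primrec.fst)
    · exact hQ.comp (Primrec.list_take.comp (Primrec.fst.comp Primrec.snd) Primrec.fst) Primrec.snd
  · simp only [length_pre, take_pre]
    constructor
    · intro h
      split_ifs at h with hq
      · refine ⟨a.1, ?_⟩
        rw [min_self, if_pos ⟨le_rfl, hq⟩, Part.mem_some_iff.1 h]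
      · simp at h
    · rintro ⟨s, hs⟩
      split_ifs at hs with hq
      rw [min_eq_left hq.1] at hq
      rw [if_pos hq.2, Part.mem_some_iff, Option.some_inj.1 hs]
  · change _ ↔ (if Q (pre (bit I) p.n) p.code then Part.some 0 else Part.none).Dom
    split_ifs with h <;> simp [h]

/-- The extension of `r` to length `N` whose new pairs of new points have color `1`, while the
new points promise the limit color `0`. -/
def Condition.stretch (r : Condition) (N : ℕ) : Condition where
  n := N
  c := fun e => if h : e.1.2 < r.n then r.c ⟨e.1, e.2.2.2.trans h, h, e.2.2.2⟩
    else if h' : e.1.1 < r.n then (r.l ⟨e.1.1, h'⟩).1 else 1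
  -- The threshold `N` makes the promise of a new point vacuous below `N`, so color `1` between new
  -- points is compatible with limit color `0`.
  l := fun x => if h : (x : ℕ) < r.n then r.l ⟨x, h⟩ else (0, N)
  compat := by
    rintro x e hx hl
    have hxN := x.2
    have heN : e.1.2 < N := e.2.2.1
    by_cases h : (x : ℕ) < r.n
    · simp only [h, dif_pos] at hl ⊢
      by_cases h2 : e.1.2 < r.n
      · rw [dif_pos h2]
        exact r.compat ⟨x, h⟩ ⟨e.1, e.2.2.2.trans h2, h2, e.2.2.2⟩ hx hl
      · rw [dif_neg h2, dif_pos (by rw [hx]; exact h)]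
        simp only [hx]
    · simp only [h, dif_neg, not_false_eq_true] at hl
      omega

theorem Condition.stretch_extends (r : Condition) {N : ℕ} (h : r.n ≤ N) :
    (r.stretch N).Extends r := by
  refine ⟨h, fun e => ?_, fun x => ?_⟩
  · have he : e.1.2 < r.n := e.2.2.1
    simp only [stretch, Pairs.incl, dif_pos he]
    rfl
  · simp [stretch]

theorem Condition.conflict_stretch (r : Condition) {N x y : ℕ} (hx : r.n ≤ x) (hxy : x < y)
    (hy : y < N) : Conflict (r.stretch N).code x y := by
  rw [conflict_code hxy hy]
  have h1 : ¬ x < r.n := not_lt.2 hx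
  have h2 : ¬ y < r.n := by omega
  simp [stretch, h1, h2]

/-- Two points in conflict do not lie in a common infinite homogeneous set. -/
theorem ColoringExtends.not_homogeneous {c : Coloring Set.univ 2} {r : Condition}
    (hr : ColoringExtends c r) {x y : ℕ} (hxy : x < y) (hy : y < r.n)
    (hconf : Conflict r.code x y) {H : Set ℕ} (hH : H.Infinite) (hhom : Homogeneous c H)
    (hxH : x ∈ H) (hyH : y ∈ H) : False := by
  rw [conflict_code hxy hy] at hconf
  obtain ⟨-, j, hj⟩ := hhom
  -- Beyond the threshold of `x` the color `c(x, z)` is the promised one, which differs from `c(x,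
  -- y)`.
  obtain ⟨z, hz, hzx⟩ := hH.exists_gt (max x (r.l ⟨x, hxy.trans hy⟩).2)
  rw [max_lt_iff] at hzx
  have h1 := hr.1 ⟨(x, y), hxy.trans hy, hy, hxy⟩
  have h2 := hr.2 ⟨x, hxy.trans hy⟩ ⟨(x, z), trivial, trivial, hzx.1⟩ rfl hzx.2.le
  rw [← h1, ← h2] at hconf
  exact hconf ((hj _ hxH hyH).trans (hj _ hxH hz).symm)

end StableRamsey

namespace StableRamsey

/-! ### The forcing with finite sets and reservoirs -/

variable {k : ℕ} {X : Set ℕ} {A : Fin k → Set ℕ} {c : Coloring Set.univ 2}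

/-- Finite approximations `F i ⊆ A i` to the sets being constructed, with a common reservoir over
which `X` has PA degree. -/
structure Stage (X Y : Set ℕ) {k : ℕ} (A : Fin k → Set ℕ) where
  F : Fin k → Finset ℕ
  I : Set ℕ
  F_sub : ∀ i, (F i : Set ℕ) ⊆ A i
  I_sub : I ⊆ Y
  inf : I.Infinite
  pa : PAOver X I

variable {Y : Set ℕ}

instance : Preorder (Stage X Y A) where
  le q p := (∀ i, p.F i ⊆ q.F i) ∧ (∀ i, (q.F i : Set ℕ) ⊆ p.F i ∪ p.I) ∧ q.I ⊆ p.I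
  le_refl p := ⟨fun _ => subset_rfl, fun _ => Set.subset_union_left, subset_rfl⟩
  le_trans r q p hrq hqp := by
    refine ⟨fun i => (hqp.1 i).trans (hrq.1 i), fun i x hx => ?_, hrq.2.2.trans hqp.2.2⟩
    rcases hrq.2.1 i hx with h | h
    · exact hqp.2.1 i h
    · exact Or.inr (hqp.2.2 h)

/-- `L` is a possible `i`th set for the stage `p`. -/
def Stage.Allows (p : Stage X Y A) (i : Fin k) (L : Set ℕ) : Prop :=
  (p.F i : Set ℕ) ⊆ L ∧ L ⊆ p.F i ∪ p.I

/-- `φ`, run on `L`, accepts exactly the elements of an infinite homogeneous set for `c`. -/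
def Solves (c : Coloring Set.univ 2) (φ : List Bool → ℕ → Option ℕ) (L : Set ℕ) : Prop :=
  ∃ H : Set ℕ, H.Infinite ∧ Homogeneous c H ∧ ∀ x, x ∈ H ↔ ∃ s, φ (pre (bit L) s) x = some 1

/-! ### Defeating one functional of a tuple -/

/-- The sequence of blocks of length `k` describing the sets `A i`. -/
def blockSet (A : Fin k → Set ℕ) : Set ℕ := {m | ∃ i : Fin k, ∃ x ∈ A i, m = k * x + i}

theorem mem_blockSet {i : Fin k} {x : ℕ} : k * x + i ∈ blockSet A ↔ x ∈ A i := by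
  constructor
  · rintro ⟨j, y, hy, h⟩
    have hk : 0 < k := i.pos
    have hx : x = y := by
      have := congrArg (· / k) h
      simpa [Nat.mul_add_div hk, Nat.div_eq_of_lt i.2, Nat.div_eq_of_lt j.2] using this
    subst hx
    have : i = j := Fin.ext (by omega)
    exact this ▸ hy
  · exact fun h => ⟨i, x, h, rfl⟩

/-- The case where `c` meets the class: the actual cover splits, so the finite set witnessing this
lies in the right part and may be added to the stage. The functional then accepts a conflicting
pair. -/
theorem Stage.exists_of_splits (p : Stage X Y A) {φ : Fin k → List Bool → ℕ → Option ℕ}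
    {r : Condition} (hr : ColoringExtends c r)
    (hsplit : Splits p.F φ (Conflict r.code) (pre (bit p.I) r.n) (pre (bit (blockSet A)) r.n)) :
    ∃ q ≤ p, ∃ i, ∀ L, q.Allows i L → ¬ Solves c (φ i) L := by
  obtain ⟨i, τ, hτ, hfit, x, hx, y, hy, hxy, hconf, hφx, hφy⟩ := hsplit
  rw [length_pre] at hx hy
  let G : Finset ℕ := {z ∈ Finset.range τ.length | τ[z]? = some true}
  have hmemG : ∀ z, z ∈ G ↔ τ[z]? = some true := by
    intro z
    simp only [G, Finset.mem_filter, Finset.mem_range, and_iff_right_iff_imp]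
    exact fun h => (List.getElem?_eq_some_iff.1 h).1
  have hG : ∀ z ∈ G, z ∈ p.F i ∨ (z ∈ p.I ∧ z ∈ A i) := by
    intro z hz
    have hz' := (hmemG z).1 hz
    refine ((hfit z (List.getElem?_eq_some_iff.1 hz').1).2 hz').imp_right fun h => ?_
    simp only [getElem?_pre] at h
    obtain ⟨h1, h2⟩ := h
    split_ifs at h1 h2
    rw [Option.some_inj, bit_eq_true] at h1 h2
    exact ⟨h1, mem_blockSet.1 h2⟩
  let q : Stage X Y A :=
    { F := Function.update p.F i (p.F i ∪ G)
      -- The order on stages does not require end extensions, so the reservoir is cut here to freeze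
      -- membership below `τ.length`.
      I := p.I ∩ Set.Ici τ.length
      F_sub := fun j => by
        rcases eq_or_ne j i with rfl | hj
        · rw [Function.update_self]
          intro z hz
          rcases Finset.mem_union.1 hz with h | h
          · exact p.F_sub _ h
          · exact (hG z h).elim (fun h => p.F_sub _ h) fun h => h.2
        · rw [Function.update_of_ne hj]
          exact p.F_sub j
      I_sub := Set.inter_subset_left.trans p.I_sub
      inf := infinite_inter_Ici p.inf _
      pa := p.pa.inter_Ici _ }
  refine ⟨q, ⟨fun j => ?_, fun j => ?_, Set.inter_subset_left⟩, i, ?_⟩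
  · change p.F j ⊆ Function.update p.F i (p.F i ∪ G) j
    rcases eq_or_ne j i with rfl | hj
    · rw [Function.update_self]
      exact Finset.subset_union_left
    · rw [Function.update_of_ne hj]
  · change ((Function.update p.F i (p.F i ∪ G) j : Finset ℕ) : Set ℕ) ⊆ _
    rcases eq_or_ne j i with rfl | hj
    · rw [Function.update_self]
      intro z hz
      rcases Finset.mem_union.1 hz with h | h
      · exact Or.inl h
      · exact (hG z h).imp_right fun h => h.1
    · rw [Function.update_of_ne hj]
      exact Set.subset_union_left
  · rintro L ⟨hL1, hL2⟩ ⟨H, hH, hhom, hcomp⟩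
    have hqF : q.F i = p.F i ∪ G := Function.update_self ..
    rw [hqF] at hL1 hL2
    -- Every set still allowed has `τ` as an initial segment, so the computations accepting `x` and
    -- `y` from `τ` are computations from `L`.
    have hpre : pre (bit L) τ.length = τ := by
      apply List.ext_getElem?
      intro z
      rw [getElem?_pre]
      split_ifs with hz
      · have hzτ : τ[z]? = some true ↔ z ∈ L := by
          constructor
          · exact fun h => hL1 (Finset.mem_union_right _ ((hmemG z).2 h))
          · intro h
            rcases hL2 h with h | h
            · rcases Finset.mem_union.1 h with h | h
              · exact (hfit z hz).1 h
              · exact (hmemG z).1 h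
            · exact absurd h.2 (not_le.2 hz)
        rw [List.getElem?_eq_getElem hz] at hzτ ⊢
        rw [Option.some_inj] at hzτ ⊢
        rw [Bool.eq_iff_iff, hzτ, bit_eq_true]
      · rw [List.getElem?_eq_none (not_lt.1 hz)]
    exact hr.not_homogeneous hxy hy hconf hH hhom
      ((hcomp x).2 ⟨τ.length, by rw [hpre]; exact hφx⟩)
      ((hcomp y).2 ⟨τ.length, by rw [hpre]; exact hφy⟩)

/-- The case where the class is avoided: a path through the tree of nonsplitting covers partitions
the reservoir. Inside any part, the corresponding functional never accepts two numbers `x < y` with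
`n₀ ≤ x`, hence accepts no infinite set. -/
theorem Stage.exists_of_not_splits (p : Stage X Y A) {φ : Fin k → List Bool → ℕ → Option ℕ}
    (hφ : ∀ i, Primrec₂ (φ i)) (hmono : ∀ i, MonoApprox (φ i)) (n₀ : ℕ)
    (h : ∀ n, ∃ σ : List Bool, σ.length = n ∧ Covers k (pre (bit p.I) n) σ ∧
      ¬ Splits p.F φ (fun x _ => n₀ ≤ x) (pre (bit p.I) n) σ) :
    ∃ q ≤ p, ∃ i, ∀ L, q.Allows i L → ¬ Solves c (φ i) L := by
  -- A path computed by `X` alone might not leave `X` of PA degree over the new reservoir. A path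
  -- computed by `Z` makes the reservoir computable from `Z`, and `Z ≪ X`.
  obtain ⟨Z, hZI, hXZ⟩ := p.pa.exists_between
  obtain ⟨P, hP, hpath⟩ := hZI.exists_path
    (R := fun ι σ => Covers k ι σ ∧ ¬ Splits p.F φ (fun x _ => n₀ ≤ x) ι σ)
    ((primrecRel_covers k).and (PrimrecPred.not
      ((primrecPred_splits (α := ℕ) p.F hφ (R := fun a x _ => a ≤ x)
        (Primrec.nat_le.comp Primrec.fst (Primrec.fst.comp Primrec.snd))).comp
        (Primrec.pair (Primrec.const n₀) Primrec.id))))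
    (fun σ τ hτ hσ => ⟨hσ.1.of_prefix (pre_prefix _ hτ.length_le) hτ,
      fun hs => hσ.2 (hs.of_prefix (pre_prefix _ hτ.length_le) hτ)⟩) h
  let J : Fin k → Set ℕ := fun i => p.I ∩ {x | P (k * x + i) = true}
  have hJ : ∃ i, (J i).Infinite := by
    by_contra! hcon
    refine p.inf ((Set.finite_iUnion fun i => Set.not_infinite.1 (by simpa using hcon i)).subset
      fun x hx => ?_)
    -- This length exceeds `x` and contains the whole block of `x`.
    obtain ⟨i, hi⟩ := (hpath (k * x + k + x + 1)).1 x (by rw [length_pre]; omega)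
      (by rw [length_pre]; omega) (by
        rw [getElem?_pre, if_pos (by omega), Option.some_inj, bit_eq_true]
        exact hx)
    rw [getElem?_pre] at hi
    split_ifs at hi
    exact Set.mem_iUnion.2 ⟨i, hx, Option.some_inj.1 hi⟩
  obtain ⟨i, hi⟩ := hJ
  let q : Stage X Y A :=
    { F := p.F
      I := J i
      F_sub := p.F_sub
      I_sub := Set.inter_subset_left.trans p.I_sub
      inf := hi
      pa := hXZ.mono_right (hZI.computableFrom.inter (computableFrom_setOf hP
        (Primrec.nat_add.comp (Primrec.nat_mul.comp (Primrec.const k) Primrec.id)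
          (Primrec.const _)))) }
  refine ⟨q, ⟨fun _ => subset_rfl, fun _ => Set.subset_union_left, Set.inter_subset_left⟩, i, ?_⟩
  rintro L ⟨hL1, hL2⟩ ⟨H, hH, -, hcomp⟩
  change (p.F i : Set ℕ) ⊆ L at hL1
  change L ⊆ p.F i ∪ J i at hL2
  obtain ⟨x, hxH, hx⟩ := hH.exists_gt n₀
  obtain ⟨y, hyH, hy⟩ := hH.exists_gt x
  obtain ⟨s, hs⟩ := (hcomp x).1 hxH
  obtain ⟨t, ht⟩ := (hcomp y).1 hyH
  set u := max s t
  -- The initial segment of `L` of length `u` would itself witness a splitting. The level is large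
  -- enough to contain `x`, `y` and the blocks of all numbers below `u`.
  refine (hpath (k * u + u + y + 1)).2 ⟨i, pre (bit L) u, mem_boolLists.2 ?_, ?_, x, ?_, y, ?_, hy,
    hx.le, (hmono i).pre (le_max_left _ _) hs, (hmono i).pre (le_max_right _ _) ht⟩
  · simp only [length_pre]
    omega
  · intro z hz
    rw [length_pre] at hz
    have hk : k * z + i < k * u := by
      have h1 : k * (z + 1) ≤ k * u := Nat.mul_le_mul_left k hz
      have h2 := i.2
      rw [Nat.mul_add, Nat.mul_one] at h1
      omega
    rw [getElem?_pre, getElem?_pre, getElem?_pre, if_pos hz, if_pos (by omega), if_pos (by omega),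
      Option.some_inj, Option.some_inj, Option.some_inj, bit_eq_true, bit_eq_true]
    exact ⟨fun h => hL1 h, fun h => hL2 h⟩
  · simp only [length_pre]
    omega
  · simp only [length_pre]
    omega

/-- Below every stage there is one that prevents one of the functionals `φ i` from computing an
infinite homogeneous set. -/
theorem Stage.exists_not_solves (hc : OneGeneric X c) (hA : Y ⊆ ⋃ i, A i) (p : Stage X Y A)
    {φ : Fin k → List Bool → ℕ → Option ℕ} (hφ : ∀ i, Primrec₂ (φ i))
    (hmono : ∀ i, MonoApprox (φ i)) :
    ∃ q ≤ p, ∃ i, ∀ L, q.Allows i L → ¬ Solves c (φ i) L := by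
  -- The parts `A i` need not be computable from `X`, so the class quantifies over all finite covers
  -- instead of naming the actual one.
  let Q : List Bool → ℕ × List (List (Fin 2)) × List (Fin 2 × ℕ) → Prop := fun ι a =>
    ∀ σ ∈ boolLists a.1, σ.length = a.1 → Covers k ι σ → Splits p.F φ (Conflict a) ι σ
  have hQ : PrimrecRel Q := by
    refine primrecPred_ball_mem (primrec_boolLists.comp (Primrec.fst.comp Primrec.snd))
      (primrecPred_imp ?_ (primrecPred_imp ?_ ?_))
    · exact Primrec.eq.comp (Primrec.list_length.comp Primrec.snd)
        (Primrec.fst.comp (Primrec.snd.comp Primrec.fst))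
    · exact (primrecRel_covers k).comp (Primrec.fst.comp Primrec.fst) Primrec.snd
    · exact (primrecPred_splits p.F hφ primrecPred_conflict).comp
        (Primrec.pair (Primrec.snd.comp Primrec.fst) (Primrec.pair (Primrec.fst.comp Primrec.fst)
          Primrec.snd))
  obtain ⟨r, hr, hmeet | havoid⟩ := hc _ (sigmaOne_of_primrec p.pa.computableFrom hQ)
  · refine p.exists_of_splits hr (hmeet _ (mem_boolLists.2 (length_pre _ _).le) (length_pre _ _) ?_)
    intro x _ hxk hxI
    rw [length_pre] at hxk
    rw [getElem?_pre] at hxI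
    split_ifs at hxI
    rw [Option.some_inj, bit_eq_true] at hxI
    obtain ⟨i, hi⟩ := Set.mem_iUnion.1 (hA (p.I_sub hxI))
    refine ⟨i, ?_⟩
    have := i.2
    rw [getElem?_pre, if_pos (by omega), Option.some_inj, bit_eq_true]
    exact mem_blockSet.2 hi
  · refine p.exists_of_not_splits hφ hmono r.n fun n => ?_
    -- All pairs of points from `r.n` on conflict in the stretched condition, so a cover that avoids
    -- splitting there has no accepted pair above `r.n`. The maximum ensures an extension of `r`
    -- even for small `n`; truncating to length `n` is harmless.
    have hnot := havoid _ (r.stretch_extends (le_max_right n r.n))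
    change ¬ Q (pre (bit p.I) (max n r.n)) (r.stretch (max n r.n)).code at hnot
    simp only [Q, not_forall] at hnot
    obtain ⟨σ, -, hlen, hcov, hns⟩ := hnot
    change σ.length = max n r.n at hlen
    refine ⟨σ.take n, by simp [hlen], hcov.of_prefix (pre_prefix _ (le_max_left _ _))
      (List.take_prefix _ _), fun hs => hns ?_⟩
    refine (hs.of_prefix (pre_prefix _ (le_max_left _ _)) (List.take_prefix _ _)).mono
      fun x y hxy hy hx => r.conflict_stretch hx hxy ?_
    rwa [← hlen]

theorem Stage.exists_large (hmeet : ∀ I ⊆ Y, I.Infinite → PAOver X I → ∀ i, (A i ∩ I).Nonempty)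
    (p : Stage X Y A) (i : Fin k) (n : ℕ) : ∃ q ≤ p, ∃ x ∈ q.F i, n ≤ x := by
  obtain ⟨x, hxA, hxI, hx⟩ := hmeet (p.I ∩ Set.Ici n) (Set.inter_subset_left.trans p.I_sub)
    (infinite_inter_Ici p.inf n) (p.pa.inter_Ici n) i
  refine ⟨{ p with
    F := Function.update p.F i (insert x (p.F i))
    F_sub := fun j => ?_ }, ⟨fun j => ?_, fun j => ?_, subset_rfl⟩, x, ?_, hx⟩
  · rcases eq_or_ne j i with rfl | hj
    · rw [Function.update_self, Finset.coe_insert]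
      exact Set.insert_subset hxA (p.F_sub _)
    · rw [Function.update_of_ne hj]
      exact p.F_sub j
  · change p.F j ⊆ Function.update p.F i (insert x (p.F i)) j
    rcases eq_or_ne j i with rfl | hj
    · rw [Function.update_self]
      exact Finset.subset_insert _ _
    · rw [Function.update_of_ne hj]
  · change ((Function.update p.F i (insert x (p.F i)) j : Finset ℕ) : Set ℕ) ⊆ _
    rcases eq_or_ne j i with rfl | hj
    · rw [Function.update_self, Finset.coe_insert]
      exact Set.insert_subset (Or.inr hxI) Set.subset_union_left
    · rw [Function.update_of_ne hj]
      exact Set.subset_union_left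
  · change x ∈ Function.update p.F i (insert x (p.F i)) i
    rw [Function.update_self]
    exact Finset.mem_insert_self _ _

/-! ### The countably many requirements and the generic construction -/

/-- The monotone primitive recursive approximations. -/
abbrev Functional : Type :=
  {φ : List Bool → ℕ → Option ℕ // Primrec₂ φ ∧ MonoApprox φ}

instance : Countable Functional := by
  let g : Functional → {f : ℕ → ℕ // Computable f} := fun φ =>
    ⟨fun n => Encodable.encode ((Encodable.decode (α := List Bool × ℕ) n).bind
      fun p => φ.1 p.1 p.2), by
      refine (Primrec.encode.comp (Primrec.option_bind Primrec.decode (Primrec₂.mk ?_))).to_comp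
      exact φ.2.1.comp (Primrec.fst.comp Primrec.snd) (Primrec.snd.comp Primrec.snd)⟩
  refine Function.Injective.countable (f := g) fun φ ψ h => Subtype.ext ?_
  funext τ n
  have := congrFun (congrArg Subtype.val h) (Encodable.encode (τ, n))
  simpa [g] using this

/-- The Rasiowa–Sikorski argument: enumerate the dense requirements and meet them in turn. -/
theorem exists_generic_sequence {ι S : Type*} [Preorder S] [Countable ι] [Nonempty ι]
    {D : ι → S → Prop} (hD : ∀ i p, ∃ q ≤ p, D i q) (p : S) :
    ∃ f : ℕ → S, Antitone f ∧ ∀ i, ∃ n, D i (f n) := by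
  obtain ⟨e, he⟩ := exists_surjective_nat ι
  choose g hg hgD using hD
  refine ⟨fun n => n.rec p fun n q => g (e n) q, antitone_nat_of_succ_le fun n => hg _ _,
    fun i => ?_⟩
  obtain ⟨n, rfl⟩ := he i
  exact ⟨n + 1, hgD _ _⟩

/-- If every reservoir meets every part of a cover of `Y`, then some part has an infinite subset
computing no infinite homogeneous set for `c`. -/
theorem exists_subset_of_meets (hc : OneGeneric X c) (hY : Y.Infinite) (hXY : PAOver X Y)
    (hA : Y ⊆ ⋃ i, A i)
    (hmeet : ∀ I ⊆ Y, I.Infinite → PAOver X I → ∀ i, (A i ∩ I).Nonempty) :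
    ∃ i, ∃ L ⊆ A i, L.Infinite ∧
      ¬ ∃ H : Set ℕ, H.Infinite ∧ ComputableFrom H L ∧ Homogeneous c H := by
  -- The requirements range over tuples because there is no control over which entry gets defeated.
  let D : (Fin k → Functional) ⊕ (Fin k × ℕ) → Stage X Y A → Prop := Sum.elim
    (fun φ q => ∃ i, ∀ L, q.Allows i L → ¬ Solves c (φ i).1 L)
    (fun a q => ∃ x ∈ q.F a.1, a.2 ≤ x)
  have hk : Nonempty (Fin k) := by
    obtain ⟨y, hy⟩ := hY.nonempty
    obtain ⟨i, -⟩ := Set.mem_iUnion.1 (hA hy)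
    exact ⟨i⟩
  have hD : ∀ a p, ∃ q ≤ p, D a q := by
    rintro (φ | ⟨i, n⟩) p
    · exact p.exists_not_solves hc hA (fun i => (φ i).2.1) fun i => (φ i).2.2
    · exact p.exists_large hmeet i n
  obtain ⟨f, hf, hfD⟩ := exists_generic_sequence hD
    { F := fun _ => ∅, I := Y, F_sub := by simp, I_sub := subset_rfl, inf := hY, pa := hXY }
  let L : Fin k → Set ℕ := fun i => ⋃ n, ((f n).F i : Set ℕ)
  have hallow : ∀ n i, (f n).Allows i (L i) := by
    refine fun n i => ⟨Set.subset_iUnion (fun n => ((f n).F i : Set ℕ)) n,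
      Set.iUnion_subset fun m => ?_⟩
    rcases le_total n m with h | h
    · exact (hf h).2.1 i
    · exact (Finset.coe_subset.2 ((hf h).1 i)).trans Set.subset_union_left
  have hLA : ∀ i, L i ⊆ A i := fun i => Set.iUnion_subset fun n => (f n).F_sub i
  have hLinf : ∀ i, (L i).Infinite := by
    intro i
    refine Set.infinite_of_not_bddAbove ?_
    rintro ⟨N, hN⟩
    obtain ⟨n, x, hx, hNx⟩ := hfD (Sum.inr (i, N + 1))
    have h1 : x ≤ N := hN (Set.mem_iUnion.2 ⟨n, hx⟩)
    have h2 : N + 1 ≤ x := hNx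
    omega
  by_contra! hcon
  -- If every `L i` failed, choosing a successful functional for each `i` would give a tuple no
  -- entry of which was defeated.
  have hsolve : ∀ i, ∃ φ : Functional, Solves c φ.1 (L i) := by
    intro i
    obtain ⟨H, hH, hcomp, hhom⟩ := hcon i (L i) (hLA i) (hLinf i)
    obtain ⟨φ, h1, h2, h3⟩ := exists_approx hcomp
    refine ⟨⟨φ, h1, h2⟩, H, hH, hhom, fun x => ?_⟩
    rw [← h3, chi_eq, Part.mem_some_iff, ← bit_eq_true]
    cases bit H x <;> simp
  choose φ hφ using hsolve
  obtain ⟨n, i, hi⟩ := hfD (Sum.inl φ)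
  exact hi _ (hallow n i) (hφ i)

/-- Every finite cover of `Y` has a part with an infinite subset computing no infinite homogeneous
set for `c`. -/
theorem exists_subset_of_cover (hc : OneGeneric X c) (hY : Y.Infinite) (hXY : PAOver X Y)
    (hA : Y ⊆ ⋃ i, A i) :
    ∃ i, ∃ L ⊆ A i, L.Infinite ∧
      ¬ ∃ H : Set ℕ, H.Infinite ∧ ComputableFrom H L ∧ Homogeneous c H := by
  induction k generalizing Y with
  | zero =>
    obtain ⟨y, hy⟩ := hY.nonempty
    obtain ⟨i, -⟩ := Set.mem_iUnion.1 (hA hy)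
    exact i.elim0
  | succ k ih =>
    by_cases hmeet : ∀ I ⊆ Y, I.Infinite → PAOver X I → ∀ i, (A i ∩ I).Nonempty
    · exact exists_subset_of_meets hc hY hXY hA hmeet
    · push Not at hmeet
      -- The reservoir `I` misses part `i`, so the remaining parts cover `I`, which takes over the
      -- role of `Y`.
      obtain ⟨I, hIY, hI, hXI, i, hi⟩ := hmeet
      obtain ⟨j, hj⟩ := ih (A := fun j => A (i.succAbove j)) hI hXI fun x hx => by
        obtain ⟨l, hl⟩ := Set.mem_iUnion.1 (hA (hIY hx))
        have hli : l ≠ i := by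
          rintro rfl
          exact Set.eq_empty_iff_forall_notMem.1 hi x ⟨hl, hx⟩
        obtain ⟨j, rfl⟩ := Fin.exists_succAbove_eq hli
        exact Set.mem_iUnion.2 ⟨j, hl⟩
      exact ⟨_, hj⟩

end StableRamsey

theorem mainTheorem9 (X : Set ℕ) (hX : StableRamsey.HasPADegree X)
    (c : StableRamsey.Coloring Set.univ 2) (hc : StableRamsey.OneGeneric X c)
    (k : ℕ) (hk : 2 ≤ k)
    (Y : Set ℕ) (hYinf : Y.Infinite) (hY : StableRamsey.PAOver X Y)
    (d : StableRamsey.Coloring Y k) (hd : StableRamsey.Stable d) :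
    ∃ L : Set ℕ, L.Infinite ∧ L ⊆ Y ∧ StableRamsey.LimitHomogeneous d L ∧
      ¬ ∃ H : Set ℕ, H.Infinite ∧ StableRamsey.ComputableFrom H L ∧
        StableRamsey.Homogeneous c H := by
  obtain ⟨j, L, hL, hinf, hcomp⟩ := StableRamsey.exists_subset_of_cover
    (A := fun j => {x | x ∈ Y ∧ StableRamsey.LimitColor d x j}) hc hYinf hY fun x hx => by
      obtain ⟨j, hj⟩ := hd x hx
      exact Set.mem_iUnion.2 ⟨j, hx, hj⟩
  have hLY : L ⊆ Y := fun x hx => (hL hx).1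
  exact ⟨L, hinf, hLY, ⟨hLY, j, fun x hx => (hL hx).2⟩, hcomp⟩
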